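/- **Model.** An instance of *Buying Information for Min Sum Set Cover* consists of $n$ boxes, a finite list of scenarios $s\in\{0,1\}^n$ (repetitions allowed) with a probability distribution $\mathcal D$ on the list, a sequence of deterministic signaling schemes $f_0,f_1,\dots$ (each assigns a real number to every scenario of the list), and prices $c_0,c_1,\dots:\mathbb R\to\mathbb Z_{\ge 0}$ such that for every scenario $s$ of positive probability $c_t(f_t(s))>0$ for infinitely many $t$ (e.g. all prices are positive integers). A scenario $s$ is drawn from $\mathcal D$ and the signal $y_0=f_0(s)$ is received. Repeatedly, a learner either pays $c_t(y_t)$ to receive the next signal $y_{t+1}=f_{t+1}(s)$, where $y_t$ is the last signal received, or pays $1$ to query a box $i$ and observe $s_i$; the process ends when $s$ is covered, i.e. when a box with $s_i=1$ is queried. With each signal $y_t$ the learner is told the set of scenarios consistent with $y_0,\dots,y_t$ and the price $c_t(y_t)$ of the next signal; a learner is a function from the boxes, the scenarios, $\mathcal D$ and all observations so far to the next decision. $\mathrm{cost}(\mathcal A,I)$ is the expected total payment of the learner $\mathcal A$ on the instance $I$ ($\infty$ if with positive probability $s$ is never covered), and $\mathrm{OPT}(I)=\inf_{\mathcal A'}\mathrm{cost}(\mathcal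 A',I)$ over all learners $\mathcal A'$, which may depend on $I$ (a prophet who knows all $f_t$ and $c_t$ in advance). *GreedyBuying*: after receiving $y_t$, make $c_t(y_t)$ queries (stopping once $s$ is covered), each of a box $i$ that maximizes the probability of $s_i=1$ conditioned on the scenario being consistent with all signals and query outcomes observed so far; then pay $c_t(y_t)$ to receive $y_{t+1}$; and so on. (If $n=0$ there is nothing to query.) **Theorem.** There is a single learner $\mathcal A$, which executes GreedyBuying with some rule for breaking ties, such that 1. $\mathrm{cost}(\mathcal A,I)\le 8\,\mathrm{OPT}(I)$ for every instance $I$; 2. $\mathcal A$ runs in polynomial time: if the probabilities are rational, given by integer weights $w_s$ as $w_s/\sum_r w_r$, then every decision of $\mathcal A$ is computed by one fixed random access machine program in time (logarithmic cost) polynomial in the length of the binary description of the boxes, the scenarios, the weights and the observations so far (consistent sets, prices, query outcomes). Moreover, for every instance and every drawn scenario $s\neq 0$ of positive probability, the total payment until $s$ is covered is at most $2n$, so that at most $2n$ decisions other than receiving a signal at price $0$ are made. -/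

import Mathlib

open scoped ENNReal

namespace BuyingInfo

/-! ## Min Sum Set Cover -/

/-- A Min Sum Set Cover problem with `n` boxes and `m` scenarios.  Scenario `s` is the binary vector
`vec s`, where `vec s i = true` means that box `i` contains the number 1, and `D` is the prior.
Scenarios are listed by an index, so a vector may occur several times (copies of a scenario that
receive different signals). -/
structure MSSC (n m : ℕ) where
  vec : Fin m → Fin n → Bool
  D : PMF (Fin m)

/-- What a learner does next: buy the next signal, or query a box. -/
inductive Action (n : ℕ) where
  | buy : Action n
  | query (i : Fin n) : Action n

/-- What a learner observes. `signal y S c`: it receives the signal `y`, together with the set `S` of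
scenarios consistent with all signals received so far (which, with the prior, gives the posterior)
and with the price `c` of the next signal. `miss i`: it queries box `i` and finds the number 0.
(Finding the number 1 ends the process.) -/
inductive Event (n m : ℕ) where
  | signal (y : ℝ) (S : Finset (Fin m)) (c : ℕ) : Event n m
  | miss (i : Fin n) : Event n m

/-- A deterministic adaptive learner: it chooses an action from the Min Sum Set Cover problem and
everything observed so far (most recent observation first). -/
def Learner : Type := ∀ n m : ℕ, MSSC n m → List (Event n m) → Action n

/-! ## Buying information for Min Sum Set Cover -/

/-- An instance. `f t` is the `t`-th (deterministic) signaling scheme; the signal `f 0 s` is received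
at the beginning. `c t y` is the price of the signal number `t + 1` when the signal number `t` is
`y`.  Signals may be free, but not all signals from some moment on. -/
structure Instance (n m : ℕ) extends MSSC n m where
  f : ℕ → Fin m → ℝ
  c : ℕ → ℝ → ℕ
  not_eventually_free : ∀ s ∈ D.support, ∀ t, ∃ t' ≥ t, 0 < c t' (f t' s)

namespace Instance

variable {n m : ℕ} (I : Instance n m)

/-- The observation made when the signal number `t` is received and `s` is the drawn scenario. -/
noncomputable def signalEvent (s : Fin m) (t : ℕ) : Event n m :=
  .signal (I.f t s) {r | ∀ j ≤ t, I.f j r = I.f j s} (I.c t (I.f t s))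

/-- A moment of the process: the observations made so far, the number of the last signal received,
the cost paid so far (one per query, plus the price of the signals bought), and whether the drawn
scenario is covered. -/
structure Moment (n m : ℕ) where
  history : List (Event n m)
  last : ℕ
  paid : ℕ
  covered : Bool

/-- One decision of the learner `A`, when `s` is the drawn scenario. -/
noncomputable def step (A : Learner) (s : Fin m) (x : Moment n m) : Moment n m :=
  if x.covered then x else
  match A n m I.toMSSC x.history with
  | .buy => ⟨I.signalEvent s (x.last + 1) :: x.history, x.last + 1,
      x.paid + I.c x.last (I.f x.last s), false⟩
  | .query i =>
      if I.vec s i then ⟨x.history, x.last, x.paid + 1, true⟩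
      else ⟨.miss i :: x.history, x.last, x.paid + 1, false⟩

/-- The process after `k` decisions of the learner `A`, when `s` is the drawn scenario. -/
noncomputable def run (A : Learner) (s : Fin m) (k : ℕ) : Moment n m :=
  (I.step A s)^[k] ⟨[I.signalEvent s 0], 0, 0, false⟩

/-- The cost paid by `A` until the drawn scenario `s` is covered; it is `∞` if `s` is never covered.
(Nothing is paid any more once `s` is covered.) -/
noncomputable def scenarioCost (A : Learner) (s : Fin m) : ℝ≥0∞ :=
  ⨅ (k : ℕ) (_ : (I.run A s k).covered = true), ((I.run A s k).paid : ℝ≥0∞)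

/-- The expected cost of the learner `A`. -/
noncomputable def cost (A : Learner) : ℝ≥0∞ :=
  ∑ s, I.D s * I.scenarioCost A s

/-- The optimal value. The infimum is over all learners for this fixed instance, so it is the cost
of a prophet who knows the signaling schemes and the prices in advance. -/
noncomputable def opt : ℝ≥0∞ := ⨅ A : Learner, I.cost A

end Instance

/-- `A`, which knows neither the signaling schemes nor the prices in advance, is `α`-competitive
against the prophet. -/
def Learner.Competitive (A : Learner) (α : ℝ≥0∞) : Prop :=
  ∀ (n m : ℕ) (I : Instance n m), I.cost A ≤ α * I.opt

/-! ## The learner GreedyBuying -/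

namespace MSSC

variable {n m : ℕ} (X : MSSC n m)

/-- The scenarios consistent with the signals and the outcomes observed so far. -/
def alive : List (Event n m) → Finset (Fin m)
  | [] => Finset.univ
  | .signal _ S _ :: h => alive h ∩ S
  | .miss i :: h => {s ∈ alive h | X.vec s i = false}

/-- The probability that box `i` contains 1, given that the scenario lies in `S`. -/
noncomputable def prob (S : Finset (Fin m)) (i : Fin n) : ℝ≥0∞ :=
  (∑ s ∈ S with X.vec s i = true, X.D s) / ∑ s ∈ S, X.D s

end MSSC

/-- The number of queries made since the last signal was received. -/
def queriesSinceSignal {n m : ℕ} : List (Event n m) → ℕ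
  | .miss _ :: h => queriesSinceSignal h + 1
  | _ => 0

/-- The price of the next signal. -/
def currentPrice {n m : ℕ} : List (Event n m) → ℕ
  | [] => 0
  | .signal _ _ c :: _ => c
  | .miss _ :: h => currentPrice h

/-- `A` is GreedyBuying (with some rule for breaking ties): after each signal it makes as many queries
as the price of the next signal, each of a box that is most likely to contain 1 given everything
observed so far, and then buys the next signal. -/
def Learner.IsGreedyBuying (A : Learner) : Prop :=
  ∀ (n m : ℕ) (X : MSSC n m) (h : List (Event n m)), 0 < n → h ≠ [] →
    (queriesSinceSignal h < currentPrice h →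
      ∃ i, A n m X h = .query i ∧ ∀ j, X.prob (X.alive h) j ≤ X.prob (X.alive h) i) ∧
    (currentPrice h ≤ queriesSinceSignal h → A n m X h = .buy)

/-! ## Running time: random access machine programs with logarithmic cost -/

/-- Programs of a random access machine. Registers and memory cells hold natural numbers. -/
inductive Prog where
  /-- `x := a` -/
  | const (x a : ℕ) : Prog
  /-- `x := y + z` -/
  | plus (x y z : ℕ) : Prog
  /-- `x := y - z`, or 0 if `y < z` -/
  | minus (x y z : ℕ) : Prog
  /-- `x := mem[y]` -/
  | load (x y : ℕ) : Prog
  /-- `mem[x] := y` -/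
  | store (x y : ℕ) : Prog
  /-- do `p`, then `q` -/
  | seq (p q : Prog) : Prog
  /-- if `x ≠ 0` do `p`, otherwise do `q` -/
  | cond (x : ℕ) (p q : Prog) : Prog
  /-- as long as `x ≠ 0` do `p` -/
  | loop (x : ℕ) (p : Prog) : Prog

/-- The contents of the registers and of the memory. -/
structure Store where
  reg : ℕ → ℕ
  mem : ℕ → ℕ

/-- `x := a` -/
def Store.setReg (σ : Store) (x a : ℕ) : Store := { σ with reg := Function.update σ.reg x a }

/-- `mem[b] := a` -/
def Store.setMem (σ : Store) (b a : ℕ) : Store := { σ with mem := Function.update σ.mem b a }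

/-- `p.Exec σ k σ'`: started in `σ`, the program `p` halts in `σ'` after time `k`. The time of an
instruction or test is one plus the binary lengths of the numbers and addresses that it handles. -/
inductive Prog.Exec : Prog → Store → ℕ → Store → Prop where
  | const (x a : ℕ) (σ : Store) : Exec (.const x a) σ (1 + a.size) (σ.setReg x a)
  | plus (x y z : ℕ) (σ : Store) :
      Exec (.plus x y z) σ (1 + (σ.reg y).size + (σ.reg z).size) (σ.setReg x (σ.reg y + σ.reg z))
  | minus (x y z : ℕ) (σ : Store) :
      Exec (.minus x y z) σ (1 + (σ.reg y).size + (σ.reg z).size) (σ.setReg x (σ.reg y - σ.reg z))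
  | load (x y : ℕ) (σ : Store) :
      Exec (.load x y) σ (1 + (σ.reg y).size + (σ.mem (σ.reg y)).size)
        (σ.setReg x (σ.mem (σ.reg y)))
  | store (x y : ℕ) (σ : Store) :
      Exec (.store x y) σ (1 + (σ.reg x).size + (σ.reg y).size) (σ.setMem (σ.reg x) (σ.reg y))
  | seq (p q : Prog) (k l : ℕ) (σ σ' σ'' : Store) :
      Exec p σ k σ' → Exec q σ' l σ'' → Exec (.seq p q) σ (k + l) σ''
  | condTrue (x : ℕ) (p q : Prog) (k : ℕ) (σ σ' : Store) :
      σ.reg x ≠ 0 → Exec p σ k σ' → Exec (.cond x p q) σ (1 + (σ.reg x).size + k) σ'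
  | condFalse (x : ℕ) (p q : Prog) (k : ℕ) (σ σ' : Store) :
      σ.reg x = 0 → Exec q σ k σ' → Exec (.cond x p q) σ (1 + k) σ'
  | loopDone (x : ℕ) (p : Prog) (σ : Store) :
      σ.reg x = 0 → Exec (.loop x p) σ 1 σ
  | loopStep (x : ℕ) (p : Prog) (k l : ℕ) (σ σ' σ'' : Store) :
      σ.reg x ≠ 0 → Exec p σ k σ' → Exec (.loop x p) σ' l σ'' →
      Exec (.loop x p) σ (1 + (σ.reg x).size + k + l) σ''

/-- The input `l` is written into the memory cells `0, 1, …`; all else is 0. -/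
def inputStore (l : List ℕ) : Store where
  reg _ := 0
  mem a := l.getD a 0

/-- The length of an input: the binary lengths of its entries, plus one for each entry. -/
def inputLength (l : List ℕ) : ℕ := (l.map fun a => a.size + 1).sum

/-- The code of an action. -/
def Action.code {n : ℕ} : Action n → ℕ
  | .buy => 0
  | .query i => i + 1

/-- The code of an observation. The label `y` of a signal, a real number, is left out: the set of
consistent scenarios and the price are written. -/
def Event.code {n m : ℕ} : Event n m → List ℕ
  | .signal _ S c => 1 :: c :: List.ofFn fun s : Fin m => if s ∈ S then 1 else 0
  | .miss i => [2, (i : ℕ)]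

/-- The input of a decision: `n` and `m`; for each scenario its weight (an integer) and its vector;
and then the observations made so far. -/
def inputCode {n m : ℕ} (X : MSSC n m) (W : Fin m → ℕ) (h : List (Event n m)) : List ℕ :=
  n :: m :: ((List.ofFn fun s => W s :: List.ofFn fun i => (X.vec s i).toNat).flatten ++
    h.flatMap Event.code)

/-- Every decision of the learner is computed in polynomial time: one program computes, for every
prior with rational probabilities (given by integer weights) and every list of observations, the
next action (left in register 0), within a time that is polynomial in the length of the input. -/
def Learner.PolyTime (A : Learner) : Prop :=
  ∃ (p : Prog) (P : Polynomial ℕ), ∀ (n m : ℕ) (X : MSSC n m) (W : Fin m → ℕ),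
    (∀ s, X.D s = (W s : ℝ≥0∞) / ∑ r, (W r : ℝ≥0∞)) →
    ∀ h : List (Event n m), ∃ (k : ℕ) (σ : Store),
      p.Exec (inputStore (inputCode X W h)) k σ ∧ σ.reg 0 = (A n m X h).code ∧
      k ≤ P.eval (inputLength (inputCode X W h))

/-- Few decisions are made: the cost paid (hence the number of queries, and of signals bought at a
positive price) is at most `2 n` for every possible scenario that can be covered. -/
def Learner.FewDecisions (A : Learner) : Prop :=
  ∀ (n m : ℕ) (I : Instance n m), ∀ s ∈ I.D.support, (∃ i, I.vec s i = true) →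
    I.scenarioCost A s ≤ 2 * n

end BuyingInfo

/-! GreedyBuying matches every unit paid for signals by a query made beforehand. Hence, with `q`
queries made and the next action a query, it has received exactly the signals whose total price is
at most `q`: it knows the cell `I.cell q s` of the drawn scenario `s`. If query number `q` (counted
from 0) covers `s`, the total payment is at most `2 * (q + 1)` (`scenarioCost_greedyBuying_le`).

Let a competitor have a total budget `t ≤ q + 1`. The last unit goes to the covering query, so its
signals before that query cost at most `q`, and its behaviour until success is the same throughout a
cell (`missRun_eq_of_mem_cell`). In a cell it therefore tries at most `t` fixed boxes, none covering
more of the remaining mass than the greedy box (`sum_coveredBy_le`). With `R q` the mass left by `q`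
greedy queries and `O t` the mass the competitor leaves with budget `t`, summation over the cells
gives `R q ≤ O t + t * (R q - R (q + 1))` (`greedyMass_le`). Using each budget `N + 1` for the two
steps `2 * N` and `2 * N + 1` yields `∑ R ≤ 4 * ∑ O` (`sum_le_four_mul_sum`). The greedy cost is at
most `2 * ∑ R`, the competitor's at least `∑ O`; hence the factor 8.

At most `n` queries are needed, because a greedy query always covers some still possible scenario
and so is never repeated (`greedyQuery_ne`).

For the running time, a program with three nested loops (boxes, scenarios, observations) computes
the integer weight covered by each box. It never writes to memory, and each step lengthens numbers
by at most one digit, so counting steps bounds the logarithmic cost (`Steps`). -/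

namespace BuyingInfo

/-! ## The greedy learner -/

/-- The smallest index of a maximum among `a 0, …, a (k - 1)`. -/
def firstMax {α : Type*} [LinearOrder α] (a : ℕ → α) : ℕ → ℕ
  | 0 => 0
  | k + 1 => if a (firstMax a k) < a k then k else firstMax a k

theorem firstMax_lt {α : Type*} [LinearOrder α] (a : ℕ → α) {k : ℕ} (hk : 0 < k) :
    firstMax a k < k := by
  induction k with
  | zero => omega
  | succ k ih =>
    rcases Nat.eq_zero_or_pos k with rfl | h
    · simp [firstMax]
    · have := ih h
      rw [firstMax]
      split_ifs <;> omega

theorem le_firstMax {α : Type*} [LinearOrder α] (a : ℕ → α) {j k : ℕ} (hj : j < k) :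
    a j ≤ a (firstMax a k) := by
  induction k with
  | zero => omega
  | succ k ih =>
    rw [firstMax]
    rcases Nat.lt_succ_iff_lt_or_eq.mp hj with h | rfl
    · split_ifs with h'
      · exact (ih h).trans h'.le
      · exact ih h
    · split_ifs with h'
      · exact le_rfl
      · exact not_lt.mp h'

/-- Only the order of the values matters, so a program may compare integer weights instead of
probabilities and still break ties identically. -/
theorem firstMax_congr {α β : Type*} [LinearOrder α] [LinearOrder β] {a : ℕ → α} {b : ℕ → β}
    (h : ∀ i j, a i < a j ↔ b i < b j) (k : ℕ) : firstMax a k = firstMax b k := by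
  induction k with
  | zero => rfl
  | succ k ih => simp only [firstMax, ih, h]

namespace MSSC

variable {n m : ℕ} (X : MSSC n m)

/-- The mass of the scenarios in `S` that are covered by box `i`. -/
noncomputable def mass (S : Finset (Fin m)) (i : Fin n) : ℝ≥0∞ :=
  ∑ s ∈ S with X.vec s i = true, X.D s

/-- `mass`, as a function of a natural number. -/
noncomputable def score (S : Finset (Fin m)) (j : ℕ) : ℝ≥0∞ :=
  if h : j < n then X.mass S ⟨j, h⟩ else 0

/-- The first box that covers as much of `S` as possible. -/
noncomputable def greedyBox (hn : 0 < n) (S : Finset (Fin m)) : Fin n :=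
  ⟨firstMax (X.score S) n, firstMax_lt _ hn⟩

theorem mass_le_greedyBox (hn : 0 < n) (S : Finset (Fin m)) (i : Fin n) :
    X.mass S i ≤ X.mass S (X.greedyBox hn S) := by
  have h := le_firstMax (X.score S) i.2
  have h' := firstMax_lt (X.score S) hn
  simpa [score, greedyBox, h'] using h

end MSSC

/-- GreedyBuying, with ties broken in favour of the smallest index. -/
noncomputable def greedyBuying : Learner := fun n _ X h =>
  if queriesSinceSignal h < currentPrice h then
    if hn : 0 < n then .query (X.greedyBox hn (X.alive h)) else .buy
  else .buy

theorem greedyBuying_isGreedyBuying : greedyBuying.IsGreedyBuying := by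
  intro n m X h hn _
  refine ⟨fun hlt => ⟨X.greedyBox hn (X.alive h), by simp [greedyBuying, hlt, hn], fun j => ?_⟩,
    fun hle => by simp [greedyBuying, not_lt.mpr hle]⟩
  -- All boxes share the denominator of `prob`, so the largest mass is also the largest conditional
  -- probability.
  exact ENNReal.div_le_div_right (X.mass_le_greedyBox hn _ j) _

/-! ## The information available after a number of queries -/

namespace Instance

variable {n m : ℕ} (I : Instance n m)

/-- The total price of the first `t` signals bought. -/
def spent (s : Fin m) (t : ℕ) : ℕ := ∑ j ∈ Finset.range t, I.c j (I.f j s)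

theorem spent_succ (s : Fin m) (t : ℕ) :
    I.spent s (t + 1) = I.spent s t + I.c t (I.f t s) := Finset.sum_range_succ _ _

theorem spent_mono (s : Fin m) : Monotone (I.spent s) :=
  monotone_nat_of_le_succ fun t => by rw [spent_succ]; omega

theorem exists_lt_spent {s : Fin m} (hs : s ∈ I.D.support) (q : ℕ) : ∃ t, q < I.spent s t := by
  induction q with
  | zero =>
    obtain ⟨t, -, ht⟩ := I.not_eventually_free s hs 0
    exact ⟨t + 1, by rw [spent_succ]; omega⟩
  | succ q ih =>
    obtain ⟨t, ht⟩ := ih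
    obtain ⟨t', htt, ht'⟩ := I.not_eventually_free s hs t
    have := I.spent_mono s htt
    exact ⟨t' + 1, by rw [spent_succ]; omega⟩

open Classical in
/-- The scenarios that send the same signals as `s`, as far as a budget of `q` suffices. -/
noncomputable def cell (q : ℕ) (s : Fin m) : Finset (Fin m) :=
  {r | ∀ t, I.spent s t ≤ q → I.f t r = I.f t s}

variable {I} {q : ℕ} {r s : Fin m}

theorem mem_cell : r ∈ I.cell q s ↔ ∀ t, I.spent s t ≤ q → I.f t r = I.f t s := by
  simp [cell]

theorem spent_eq_of_mem_cell (h : r ∈ I.cell q s) {t : ℕ} (ht : I.spent s t ≤ q) :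
    I.spent r t = I.spent s t := by
  refine Finset.sum_congr rfl fun j hj => ?_
  rw [mem_cell.mp h j ((I.spent_mono s (Finset.mem_range.mp hj).le).trans ht)]

/-- A price depends only on the signal before it: as long as the signals are affordable they agree,
and so does the next price. -/
theorem spent_le_of_mem_cell (h : r ∈ I.cell q s) {t : ℕ} (ht : I.spent r t ≤ q) :
    I.spent s t ≤ q := by
  induction t with
  | zero => simp [spent]
  | succ t ih =>
    have h1 := ih ((I.spent_mono r t.le_succ).trans ht)
    rw [spent_succ] at ht ⊢
    rwa [← spent_eq_of_mem_cell h h1, ← mem_cell.mp h t h1]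

theorem self_mem_cell : s ∈ I.cell q s := mem_cell.mpr fun _ _ => rfl

/-- For fixed `q` the cells partition the scenarios; this permits the later summation cell by cell.
-/
theorem cell_eq_of_mem_cell (h : r ∈ I.cell q s) : I.cell q r = I.cell q s := by
  ext x
  simp only [mem_cell]
  constructor
  · intro hx t ht
    rw [hx t (by rwa [spent_eq_of_mem_cell h ht]), mem_cell.mp h t ht]
  · intro hx t ht
    have := spent_le_of_mem_cell h ht
    rw [hx t this, mem_cell.mp h t this]

theorem mem_cell_iff : r ∈ I.cell q s ↔ I.cell q r = I.cell q s :=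
  ⟨cell_eq_of_mem_cell, fun h => h ▸ self_mem_cell⟩

theorem cell_anti {p : ℕ} (hpq : p ≤ q) : I.cell q s ⊆ I.cell p s := fun _ hx =>
  mem_cell.mpr fun t ht => mem_cell.mp hx t (ht.trans hpq)

/-- Links the cell, defined by a budget, to the consistent set shown to a learner whose last signal
is number `t`. -/
theorem mem_cell_iff_of_spent {t : ℕ} (h1 : I.spent s t ≤ q) (h2 : q < I.spent s (t + 1)) :
    r ∈ I.cell q s ↔ ∀ j ≤ t, I.f j r = I.f j s := by
  rw [mem_cell]
  constructor
  · exact fun h j hj => h j ((I.spent_mono s hj).trans h1)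
  · intro h j hj
    refine h j (not_lt.mp fun hlt => ?_)
    have := I.spent_mono s (Nat.succ_le_of_lt hlt)
    simp only [Nat.succ_eq_add_one] at this
    omega

variable (I)

/-! ## The scenarios left uncovered by greedy queries -/

/-- The scenarios that are not covered by the first `q` greedy queries. -/
noncomputable def uncovered (hn : 0 < n) : ℕ → Finset (Fin m)
  | 0 => Finset.univ
  | q + 1 => {s ∈ uncovered hn q |
      I.vec s (I.greedyBox hn (uncovered hn q ∩ I.cell q s)) = false}

/-- The greedy query number `q` if `s` is the scenario. -/
noncomputable def greedyQuery (hn : 0 < n) (q : ℕ) (s : Fin m) : Fin n :=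
  I.greedyBox hn (I.uncovered hn q ∩ I.cell q s)

variable {I} (hn : 0 < n)

theorem mem_uncovered_succ : s ∈ I.uncovered hn (q + 1) ↔
    s ∈ I.uncovered hn q ∧ I.vec s (I.greedyQuery hn q s) = false := by
  simp [uncovered, greedyQuery]

theorem uncovered_anti : Antitone (I.uncovered hn) :=
  antitone_nat_of_succ_le fun _ _ h => ((mem_uncovered_succ hn).mp h).1

theorem greedyQuery_eq_of_mem_cell (h : r ∈ I.cell q s) :
    I.greedyQuery hn q r = I.greedyQuery hn q s := by
  rw [greedyQuery, greedyQuery, cell_eq_of_mem_cell h]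

theorem vec_greedyQuery_of_mem_uncovered {p : ℕ} (hpq : p < q) (hs : s ∈ I.uncovered hn q) :
    I.vec s (I.greedyQuery hn p s) = false :=
  ((mem_uncovered_succ hn).mp (uncovered_anti hn (Nat.succ_le_of_lt hpq) hs)).2

/-- Box `i` covers `s` itself and so has positive mass; the greedy box has at least as much. -/
theorem exists_mem_vec_greedyQuery (hs : s ∈ I.D.support) (hq : s ∈ I.uncovered hn q)
    {i : Fin n} (hi : I.vec s i = true) :
    ∃ r ∈ I.uncovered hn q ∩ I.cell q s, I.vec r (I.greedyQuery hn q s) = true := by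
  by_contra! hc
  have h0 : I.mass (I.uncovered hn q ∩ I.cell q s) (I.greedyQuery hn q s) = 0 := by
    rw [MSSC.mass, Finset.filter_false_of_mem fun r hr => hc r hr, Finset.sum_empty]
  have h1 : I.mass (I.uncovered hn q ∩ I.cell q s) i = 0 :=
    le_antisymm ((I.mass_le_greedyBox hn _ i).trans h0.le) bot_le
  rw [MSSC.mass, Finset.sum_eq_zero_iff] at h1
  exact (PMF.mem_support_iff _ _).mp hs (h1 s (by simp [hq, hi, self_mem_cell]))

/-- The query number `q` covers some `r` still uncovered in the cell of `s`. Cells shrink with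
growing budget, so `r` has received the same earlier queries as `s`, and all of them missed. -/
theorem greedyQuery_ne {p : ℕ} (hpq : p < q) (hs : s ∈ I.D.support) (hq : s ∈ I.uncovered hn q)
    {i : Fin n} (hi : I.vec s i = true) : I.greedyQuery hn p s ≠ I.greedyQuery hn q s := by
  obtain ⟨r, hr, hv⟩ := exists_mem_vec_greedyQuery hn hs hq hi
  rw [Finset.mem_inter] at hr
  intro h
  rw [← h, ← greedyQuery_eq_of_mem_cell hn (cell_anti hpq.le hr.2),
    vec_greedyQuery_of_mem_uncovered hn hpq hr.1] at hv
  exact Bool.false_ne_true hv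

theorem notMem_uncovered (hs : s ∈ I.D.support) {i : Fin n} (hi : I.vec s i = true) :
    s ∉ I.uncovered hn n := by
  intro h
  -- A scenario uncovered after `n` queries would give `n + 1` distinct ones, the numbers `0, …, n`,
  -- among `n` boxes.
  have hinj : Function.Injective fun q : Fin (n + 1) => I.greedyQuery hn q s := by
    intro a b hab
    by_contra hne
    rcases lt_or_gt_of_ne hne with hlt | hlt
    · exact greedyQuery_ne hn hlt hs (uncovered_anti hn (Nat.lt_succ_iff.mp b.2) h) hi hab
    · exact greedyQuery_ne hn hlt hs (uncovered_anti hn (Nat.lt_succ_iff.mp a.2) h) hi hab.symm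
  simpa using Fintype.card_le_of_injective _ hinj

theorem exists_last_uncovered (hs : s ∈ I.D.support) {i : Fin n} (hi : I.vec s i = true) :
    ∃ q < n, s ∈ I.uncovered hn q ∧ s ∉ I.uncovered hn (q + 1) := by
  by_contra! hc
  have : ∀ q ≤ n, s ∈ I.uncovered hn q := by
    intro q
    induction q with
    | zero => simp [uncovered]
    | succ q ih => exact fun hq => hc q hq (ih (by omega))
  exact notMem_uncovered hn hs hi (this n le_rfl)

/-! ## The run of the greedy learner -/

variable (I) in
theorem run_succ (A : Learner) (s : Fin m) (k : ℕ) :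
    I.run A s (k + 1) = I.step A s (I.run A s k) := Function.iterate_succ_apply' _ _ _

/-- The greedy learner has received the signal number `t`, made `q` queries, and not covered `s`. -/
structure GreedyAt (I : Instance n m) (hn : 0 < n) (s : Fin m) (q t k : ℕ) : Prop where
  last : (I.run greedyBuying s k).last = t
  paid : (I.run greedyBuying s k).paid = q + I.spent s t
  covered : (I.run greedyBuying s k).covered = false
  queries : queriesSinceSignal (I.run greedyBuying s k).history + I.spent s t = q
  price : currentPrice (I.run greedyBuying s k).history = I.c t (I.f t s)
  -- Equality means that the queries due for the current price are used up and the next action is to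
  -- buy.
  le_spent : q ≤ I.spent s (t + 1)
  mem_alive : ∀ r, r ∈ I.alive (I.run greedyBuying s k).history ↔
    r ∈ I.uncovered hn q ∧ ∀ j ≤ t, I.f j r = I.f j s

theorem greedyAt_zero : GreedyAt I hn s 0 0 0 := by
  constructor <;>
    simp [run, signalEvent, spent, queriesSinceSignal, currentPrice, MSSC.alive, uncovered]

theorem GreedyAt.buy {t k : ℕ} (h : GreedyAt I hn s q t k) (hq : I.spent s (t + 1) ≤ q) :
    GreedyAt I hn s q (t + 1) (k + 1) := by
  have h1 := h.queries
  have h2 := h.price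
  have h3 := h.le_spent
  have h4 := I.spent_succ s t
  have hA : greedyBuying n m I.toMSSC (I.run greedyBuying s k).history = .buy := by
    rw [greedyBuying, if_neg (by omega)]
  have hr : I.run greedyBuying s (k + 1) =
      ⟨I.signalEvent s (t + 1) :: (I.run greedyBuying s k).history, t + 1,
        q + I.spent s t + I.c t (I.f t s), false⟩ := by
    rw [run_succ, step, if_neg (by simp [h.covered]), hA, h.last, h.paid]
  constructor
  · rw [hr]
  · rw [hr]; simp only []; omega
  · rw [hr]
  · rw [hr]; simp only [signalEvent, queriesSinceSignal]; omega
  · rw [hr]; rfl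
  · have := I.spent_mono s (t + 1).le_succ
    simp only [Nat.succ_eq_add_one] at this
    omega
  · intro r
    rw [hr]
    simp only [signalEvent, MSSC.alive, Finset.mem_inter, h.mem_alive, Finset.mem_filter,
      Finset.mem_univ, true_and]
    exact ⟨fun hx => ⟨hx.1.1, hx.2⟩, fun hx => ⟨⟨hx.1, fun j hj => hx.2 j (by omega)⟩, hx.2⟩⟩

/-- Buys all signals due before the next query. Several may be free, but by `not_eventually_free`
the purchases stop. -/
theorem GreedyAt.exists_lt {t k : ℕ} (hs : s ∈ I.D.support) (h : GreedyAt I hn s q t k) :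
    ∃ t' k', GreedyAt I hn s q t' k' ∧ q < I.spent s (t' + 1) := by
  obtain ⟨T, hT⟩ := I.exists_lt_spent hs q
  obtain ⟨d, hd⟩ : ∃ d, T ≤ t + d := ⟨T, by omega⟩
  induction d generalizing t k with
  | zero => exact ⟨t, k, h, hT.trans_le (I.spent_mono s (by omega))⟩
  | succ d ih =>
    by_cases hlt : q < I.spent s (t + 1)
    · exact ⟨t, k, h, hlt⟩
    · exact ih (h.buy hn (not_lt.mp hlt)) (by omega)

theorem GreedyAt.alive_eq {t k : ℕ} (h : GreedyAt I hn s q t k) (hq : q < I.spent s (t + 1)) :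
    I.alive (I.run greedyBuying s k).history = I.uncovered hn q ∩ I.cell q s := by
  ext r
  have := h.queries
  rw [h.mem_alive, Finset.mem_inter, mem_cell_iff_of_spent (by omega) hq]

theorem GreedyAt.action {t k : ℕ} (h : GreedyAt I hn s q t k) (hq : q < I.spent s (t + 1)) :
    greedyBuying n m I.toMSSC (I.run greedyBuying s k).history =
      .query (I.greedyQuery hn q s) := by
  have h1 := h.queries
  have h2 := h.price
  have h4 := I.spent_succ s t
  rw [greedyBuying, if_pos (by omega), dif_pos hn, h.alive_eq hn hq, greedyQuery]

theorem GreedyAt.miss {t k : ℕ} (h : GreedyAt I hn s q t k) (hq : q < I.spent s (t + 1))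
    (hs : s ∈ I.uncovered hn (q + 1)) : GreedyAt I hn s (q + 1) t (k + 1) := by
  have h1 := h.queries
  have hr : I.run greedyBuying s (k + 1) =
      ⟨.miss (I.greedyQuery hn q s) :: (I.run greedyBuying s k).history, t,
        q + I.spent s t + 1, false⟩ := by
    rw [run_succ, step, if_neg (by simp [h.covered]), h.action hn hq, h.last, h.paid]
    simp only [((mem_uncovered_succ hn).mp hs).2]
    rfl
  constructor
  · rw [hr]
  · rw [hr]; simp only []; omega
  · rw [hr]
  · rw [hr]; simp only [queriesSinceSignal]; omega
  · rw [hr]; exact h.price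
  · exact hq
  · intro r
    rw [hr]
    simp only [MSSC.alive, Finset.mem_filter]
    rw [h.mem_alive, mem_uncovered_succ, ← mem_cell_iff_of_spent (by omega) hq]
    -- The history tests the query made for `s`, while `uncovered` tests the query made for `r`;
    -- within a cell they coincide.
    constructor
    · rintro ⟨⟨ha, hb⟩, hc⟩
      exact ⟨⟨ha, by rwa [greedyQuery_eq_of_mem_cell hn hb]⟩, hb⟩
    · rintro ⟨⟨ha, hc⟩, hb⟩
      exact ⟨⟨ha, hb⟩, by rwa [greedyQuery_eq_of_mem_cell hn hb] at hc⟩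

theorem exists_greedyAt (hs : s ∈ I.D.support) (hq : s ∈ I.uncovered hn q) :
    ∃ t k, GreedyAt I hn s q t k ∧ q < I.spent s (t + 1) := by
  induction q with
  | zero => exact (greedyAt_zero hn).exists_lt hn hs
  | succ q ih =>
    obtain ⟨t, k, h, hlt⟩ := ih ((mem_uncovered_succ hn).mp hq).1
    exact (h.miss hn hlt hq).exists_lt hn hs

theorem scenarioCost_greedyBuying_le (hs : s ∈ I.D.support) (hq : s ∈ I.uncovered hn q)
    (hq' : s ∉ I.uncovered hn (q + 1)) :
    I.scenarioCost greedyBuying s ≤ 2 * ((q + 1 : ℕ) : ℝ≥0∞) := by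
  obtain ⟨t, k, h, hlt⟩ := exists_greedyAt hn hs hq
  have hv : I.vec s (I.greedyQuery hn q s) = true := by
    simpa [mem_uncovered_succ, hq] using hq'
  have hr : I.run greedyBuying s (k + 1) =
      ⟨(I.run greedyBuying s k).history, t, q + I.spent s t + 1, true⟩ := by
    rw [run_succ, step, if_neg (by simp [h.covered]), h.action hn hlt, h.last, h.paid]
    simp only [hv]
    rfl
  refine (iInf₂_le (k + 1) (by rw [hr])).trans ?_
  have := h.queries
  rw [hr]
  -- The field `queries` gives `I.spent s t ≤ q`.
  exact_mod_cast (by omega : q + I.spent s t + 1 ≤ 2 * (q + 1))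

end Instance

theorem greedyBuying_fewDecisions : greedyBuying.FewDecisions := by
  rintro n m I s hs ⟨i, hi⟩
  have hn : 0 < n := i.pos
  obtain ⟨q, hqn, hq, hq'⟩ := Instance.exists_last_uncovered hn hs hi
  refine (Instance.scenarioCost_greedyBuying_le hn hs hq hq').trans ?_
  gcongr
  exact_mod_cast hqn

/-! ## Comparison with an arbitrary learner -/

namespace Instance

variable {n m : ℕ} (I : Instance n m) (A : Learner)

/-- One decision of the learner `A` if `s` sends the signals but all queries fail. -/
noncomputable def missStep (s : Fin m) (x : Moment n m) : Moment n m :=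
  match A n m I.toMSSC x.history with
  | .buy => ⟨I.signalEvent s (x.last + 1) :: x.history, x.last + 1,
      x.paid + I.c x.last (I.f x.last s), false⟩
  | .query i => ⟨.miss i :: x.history, x.last, x.paid + 1, false⟩

/-- The process after `k` decisions if `s` sends the signals but all queries fail. -/
noncomputable def missRun (s : Fin m) (k : ℕ) : Moment n m :=
  (I.missStep A s)^[k] ⟨[I.signalEvent s 0], 0, 0, false⟩

/-- The action number `k` if `s` sends the signals but all queries fail. -/
noncomputable def missAction (s : Fin m) (k : ℕ) : Action n :=
  A n m I.toMSSC (I.missRun A s k).history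

variable {I A} {q : ℕ} {r s : Fin m}

theorem missRun_succ (k : ℕ) : I.missRun A s (k + 1) = I.missStep A s (I.missRun A s k) :=
  Function.iterate_succ_apply' _ _ _

theorem missRun_succ_of_buy {k : ℕ} (h : I.missAction A s k = .buy) :
    I.missRun A s (k + 1) = ⟨I.signalEvent s ((I.missRun A s k).last + 1) ::
      (I.missRun A s k).history, (I.missRun A s k).last + 1,
      (I.missRun A s k).paid + I.c (I.missRun A s k).last (I.f (I.missRun A s k).last s),
      false⟩ := by
  rw [missAction] at h
  rw [missRun_succ, missStep, h]

theorem missRun_succ_of_query {k : ℕ} {i : Fin n} (h : I.missAction A s k = .query i) :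
    I.missRun A s (k + 1) = ⟨.miss i :: (I.missRun A s k).history, (I.missRun A s k).last,
      (I.missRun A s k).paid + 1, false⟩ := by
  rw [missAction] at h
  rw [missRun_succ, missStep, h]

theorem missRun_paid_mono : Monotone fun k => (I.missRun A s k).paid := by
  refine monotone_nat_of_le_succ fun k => ?_
  cases h : I.missAction A s k with
  | buy => rw [missRun_succ_of_buy h]; simp
  | query i => rw [missRun_succ_of_query h]; simp

theorem spent_le_missRun_paid (k : ℕ) :
    I.spent s (I.missRun A s k).last ≤ (I.missRun A s k).paid := by
  induction k with
  | zero => simp [missRun, spent]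
  | succ k ih =>
    cases h : I.missAction A s k with
    | buy => rw [missRun_succ_of_buy h]; simp only [spent_succ]; omega
    | query i => rw [missRun_succ_of_query h]; simp only []; omega

theorem signalEvent_eq_of_mem_cell (h : r ∈ I.cell q s) {t : ℕ} (ht : I.spent s t ≤ q) :
    I.signalEvent r t = I.signalEvent s t := by
  have hj : ∀ j ≤ t, I.f j r = I.f j s := fun j hj =>
    mem_cell.mp h j ((I.spent_mono s hj).trans ht)
  rw [signalEvent, signalEvent, hj t le_rfl]
  congr 1
  ext x
  simp only [Finset.mem_filter, Finset.mem_univ, true_and]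
  exact forall₂_congr fun j h' => by rw [hj j h']

/-- Once all queries are declared misses, the run depends on the scenario only through signals and
prices, and those affordable within `q` are constant on the cell. -/
theorem missRun_eq_of_mem_cell (h : r ∈ I.cell q s) {k : ℕ}
    (hk : (I.missRun A s k).paid ≤ q) : I.missRun A r k = I.missRun A s k := by
  induction k with
  | zero =>
    simp only [missRun, Function.iterate_zero, id]
    rw [signalEvent_eq_of_mem_cell h (by simp [spent])]
  | succ k ih =>
    have ih := ih ((missRun_paid_mono (Nat.le_succ k)).trans hk)
    have hlast := spent_le_missRun_paid (I := I) (A := A) (s := s) (k + 1)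
    have hact : I.missAction A r k = I.missAction A s k := by rw [missAction, ih, missAction]
    cases h' : I.missAction A s k with
    | buy =>
      rw [missRun_succ_of_buy (hact.trans h'), missRun_succ_of_buy h', ih]
      rw [missRun_succ_of_buy h'] at hlast hk
      simp only [] at hlast hk
      rw [signalEvent_eq_of_mem_cell h (hlast.trans hk), mem_cell.mp h _ ?_]
      exact (spent_le_missRun_paid k).trans (by omega)
    | query i => rw [missRun_succ_of_query (hact.trans h'), missRun_succ_of_query h', ih]

/-- Until success every query is a miss, so the true run cannot be told from the one in which all
queries fail. -/
theorem run_eq_missRun {k : ℕ} (h : (I.run A s k).covered = false) :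
    I.run A s k = I.missRun A s k := by
  induction k with
  | zero => rfl
  | succ k ih =>
    have hk : (I.run A s k).covered = false := by
      by_contra hc
      rw [Bool.not_eq_false] at hc
      rw [run_succ, step, if_pos hc, hc] at h
      exact Bool.false_ne_true h.symm
    have ih := ih hk
    rw [run_succ, step, if_neg (by simp [hk])] at h ⊢
    rw [missRun_succ, missStep, ← ih]
    cases hA : A n m I.toMSSC (I.run A s k).history with
    | buy => rfl
    | query i =>
      simp only [hA] at h ⊢
      split_ifs at h ⊢ with hv
      rfl

theorem exists_of_run_covered {k : ℕ} (h : (I.run A s k).covered = true) :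
    ∃ k' i, I.missAction A s k' = .query i ∧ I.vec s i = true ∧
      (I.run A s k).paid = (I.missRun A s k').paid + 1 := by
  induction k with
  | zero => simp [run] at h
  | succ k ih =>
    by_cases hk : (I.run A s k).covered = true
    · obtain ⟨k', i, h1, h2, h3⟩ := ih hk
      exact ⟨k', i, h1, h2, by rw [run_succ, step, if_pos hk, h3]⟩
    · have heq := run_eq_missRun (Bool.not_eq_true _ ▸ hk)
      rw [run_succ, step, if_neg hk] at h ⊢
      rw [heq] at h ⊢
      cases hA : I.missAction A s k with
      | buy =>
        rw [missAction] at hA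
        simp [hA] at h
      | query i =>
        refine ⟨k, i, hA, ?_⟩
        rw [missAction] at hA
        simp only [hA] at h ⊢
        split_ifs at h ⊢ with hv
        exact ⟨hv, rfl⟩

/-! ### What an arbitrary learner can cover within a budget. -/

variable (I A) in
/-- The learner `A` covers the scenario `s` and pays at most `t`. -/
def CoveredBy (t : ℕ) (s : Fin m) : Prop :=
  ∃ k, (I.run A s k).covered = true ∧ (I.run A s k).paid ≤ t

variable (I A) in
open Classical in
/-- The boxes that the learner `A` can query with a budget of `t` if the signals are those of `s`. -/
noncomputable def boxesBy (t : ℕ) (s : Fin m) : Finset (Fin n) :=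
  {i | ∃ k, I.missAction A s k = .query i ∧ (I.missRun A s k).paid < t}

theorem missRun_paid_lt {k l : ℕ} {i : Fin n} (h : I.missAction A s k = .query i) (hkl : k < l) :
    (I.missRun A s k).paid < (I.missRun A s l).paid := by
  refine lt_of_lt_of_le ?_ (missRun_paid_mono (Nat.succ_le_of_lt hkl))
  simp only [Nat.succ_eq_add_one, missRun_succ_of_query h]
  omega

/-- Label each box by the amount paid just before it is queried. Every query costs 1, so distinct
boxes get distinct labels below `t`. -/
theorem card_boxesBy_le (t : ℕ) : (I.boxesBy A t s).card ≤ t := by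
  have h : ∀ i, ∃ k, i ∈ I.boxesBy A t s →
      I.missAction A s k = .query i ∧ (I.missRun A s k).paid < t := by
    intro i
    by_cases hi : i ∈ I.boxesBy A t s
    · obtain ⟨k, hk⟩ := by simpa [boxesBy] using hi
      exact ⟨k, fun _ => hk⟩
    · exact ⟨0, fun h => absurd h hi⟩
  choose k hk using h
  have := Finset.card_le_card_of_injOn (s := I.boxesBy A t s) (t := Finset.range t)
    (fun i => (I.missRun A s (k i)).paid) (fun i hi => by simpa using (hk i hi).2) ?_
  · simpa using this
  · intro i hi j hj hij
    have h1 := (hk i hi).1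
    have h2 := (hk j hj).1
    rcases lt_trichotomy (k i) (k j) with h | h | h
    · exact absurd hij (missRun_paid_lt h1 h).ne
    · rw [h, h2] at h1
      exact (Action.query.inj h1).symm
    · exact absurd hij (missRun_paid_lt h2 h).ne'

theorem exists_mem_boxesBy {t : ℕ} (htq : t ≤ q + 1) (h : r ∈ I.cell q s)
    (hr : I.CoveredBy A t r) : ∃ i ∈ I.boxesBy A t s, I.vec r i = true := by
  obtain ⟨k, hc, hp⟩ := hr
  obtain ⟨k', i, h1, h2, h3⟩ := exists_of_run_covered hc
  have hs : s ∈ I.cell q r := mem_cell_iff.mpr (cell_eq_of_mem_cell h).symm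
  -- The covering query costs 1, so at most `t - 1 ≤ q` was paid before it; hence the condition `t ≤
  -- q + 1`.
  have heq := missRun_eq_of_mem_cell (A := A) (k := k') hs (by omega)
  refine ⟨i, ?_, h2⟩
  simp only [boxesBy, Finset.mem_filter, Finset.mem_univ, true_and]
  exact ⟨k', by rw [missAction, heq, ← h1, missAction], by rw [heq]; omega⟩

-- A union bound over the at most `t` boxes that the learner can try in this cell, each covering no
-- more of `S` than the greedy box.
open Classical in
theorem sum_coveredBy_le (hn : 0 < n) {t : ℕ} (htq : t ≤ q + 1) {S : Finset (Fin m)}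
    (hS : ∀ r ∈ S, r ∈ I.cell q s) :
    ∑ r ∈ S with I.CoveredBy A t r, I.D r ≤ t * I.mass S (I.greedyBox hn S) := by
  calc ∑ r ∈ S with I.CoveredBy A t r, I.D r
      ≤ ∑ r ∈ S, ∑ i ∈ I.boxesBy A t s, if I.vec r i = true then I.D r else 0 := by
        rw [Finset.sum_filter]
        refine Finset.sum_le_sum fun r hr => ?_
        split_ifs with hc
        · obtain ⟨i, hi, hv⟩ := exists_mem_boxesBy htq (hS r hr) hc
          refine le_trans ?_ (Finset.single_le_sum (fun _ _ => zero_le) hi)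
          rw [if_pos hv]
        · exact zero_le
    _ = ∑ i ∈ I.boxesBy A t s, I.mass S i := by
        rw [Finset.sum_comm]
        simp only [MSSC.mass, Finset.sum_filter]
    _ ≤ ∑ i ∈ I.boxesBy A t s, I.mass S (I.greedyBox hn S) :=
        Finset.sum_le_sum fun i _ => I.mass_le_greedyBox hn S i
    _ ≤ t * I.mass S (I.greedyBox hn S) := by
        rw [Finset.sum_const, nsmul_eq_mul]
        gcongr
        exact_mod_cast card_boxesBy_le t

/-! ### The inequality between uncovered masses, and its summation to the factor 8. -/

variable (I) in
/-- The probability of a scenario, as a real number. -/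
noncomputable def weight (s : Fin m) : ℝ := (I.D s).toReal

variable (I A) in
open Classical in
/-- The probability that `A` does not cover the scenario with a budget of `t`. -/
noncomputable def uncoveredMass (t : ℕ) : ℝ := ∑ s with ¬ I.CoveredBy A t s, I.weight s

variable (I) in
/-- The probability that `q` greedy queries do not cover the scenario. -/
noncomputable def greedyMass (hn : 0 < n) (q : ℕ) : ℝ := ∑ s ∈ I.uncovered hn q, I.weight s

theorem weight_nonneg (s : Fin m) : 0 ≤ I.weight s := ENNReal.toReal_nonneg

theorem toReal_sum (S : Finset (Fin m)) : (∑ s ∈ S, I.D s).toReal = ∑ s ∈ S, I.weight s :=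
  ENNReal.toReal_sum fun _ _ => PMF.apply_ne_top _ _

-- The contribution of one cell to `greedyMass_le`: remaining scenarios either escape the learner's
-- budget `t` too, or are counted by `sum_coveredBy_le`. The greedy query is constant on the cell.
open Classical in
theorem sum_uncovered_cell_le (hn : 0 < n) {t : ℕ} (htq : t ≤ q + 1) (s : Fin m) :
    ∑ r ∈ I.uncovered hn q with I.cell q r = I.cell q s, I.weight r ≤
      ∑ r with ¬ I.CoveredBy A t r ∧ I.cell q r = I.cell q s, I.weight r +
      t * ∑ r ∈ I.uncovered hn q with I.vec r (I.greedyQuery hn q r) = true ∧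
        I.cell q r = I.cell q s, I.weight r := by
  set S := I.uncovered hn q ∩ I.cell q s with hS
  have hSf : {r ∈ I.uncovered hn q | I.cell q r = I.cell q s} = S := by
    ext r
    simp [hS, mem_cell_iff]
  have h1 := sum_coveredBy_le (I := I) (A := A) (q := q) (s := s) hn htq (S := S)
    fun r hr => (Finset.mem_inter.mp hr).2
  have h2 : I.mass S (I.greedyBox hn S) =
      ∑ r ∈ I.uncovered hn q with I.vec r (I.greedyQuery hn q r) = true ∧
        I.cell q r = I.cell q s, I.D r := by
    rw [MSSC.mass]
    refine Finset.sum_congr ?_ fun _ _ => rfl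
    ext r
    simp only [hS, Finset.mem_filter, Finset.mem_inter, mem_cell_iff]
    constructor
    · rintro ⟨⟨ha, hb⟩, hc⟩
      exact ⟨ha, by rw [greedyQuery, hb]; exact hc, hb⟩
    · rintro ⟨ha, hc, hb⟩
      exact ⟨⟨ha, hb⟩, by rw [greedyQuery, hb] at hc; exact hc⟩
  rw [h2] at h1
  have h3 := ENNReal.toReal_mono (ENNReal.mul_ne_top (ENNReal.natCast_ne_top t)
    (ENNReal.sum_ne_top.mpr fun r _ => PMF.apply_ne_top _ _)) h1
  rw [ENNReal.toReal_mul, toReal_sum, toReal_sum, ENNReal.toReal_natCast] at h3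
  rw [hSf, ← Finset.sum_filter_add_sum_filter_not S (I.CoveredBy A t), add_comm]
  refine add_le_add (Finset.sum_le_sum_of_subset_of_nonneg ?_ fun r _ _ => weight_nonneg r) h3
  intro r
  simp only [hS, Finset.mem_filter, Finset.mem_inter, Finset.mem_univ, true_and, mem_cell_iff]
  tauto

open Classical in
theorem sum_eq_sum_cells (q : ℕ) (S : Finset (Fin m)) (w : Fin m → ℝ) :
    ∑ r ∈ S, w r =
      ∑ C ∈ Finset.univ.image (I.cell q), ∑ r ∈ S with I.cell q r = C, w r :=
  (Finset.sum_fiberwise_of_maps_to (fun r _ => Finset.mem_image_of_mem _ (Finset.mem_univ r)) _).symm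

theorem greedyMass_succ (hn : 0 < n) : I.greedyMass hn (q + 1) = I.greedyMass hn q -
    ∑ r ∈ I.uncovered hn q with I.vec r (I.greedyQuery hn q r) = true, I.weight r := by
  rw [eq_sub_iff_add_eq, greedyMass, greedyMass, ← Finset.sum_filter_not_add_sum_filter
    (I.uncovered hn q) fun r => I.vec r (I.greedyQuery hn q r) = true]
  congr 1
  refine Finset.sum_congr ?_ fun _ _ => rfl
  ext r
  simp [mem_uncovered_succ]

theorem greedyMass_le (hn : 0 < n) {t : ℕ} (htq : t ≤ q + 1) :
    I.greedyMass hn q ≤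
      I.uncoveredMass A t + t * (I.greedyMass hn q - I.greedyMass hn (q + 1)) := by
  classical
  rw [greedyMass_succ, sub_sub_cancel, greedyMass, uncoveredMass,
    sum_eq_sum_cells (I := I) q (I.uncovered hn q), sum_eq_sum_cells (I := I) q {s | _},
    sum_eq_sum_cells (I := I) q {r ∈ I.uncovered hn q | _}, Finset.mul_sum,
    ← Finset.sum_add_distrib]
  refine Finset.sum_le_sum fun C hC => ?_
  obtain ⟨s, -, rfl⟩ := Finset.mem_image.mp hC
  simp only [Finset.filter_filter]
  exact sum_uncovered_cell_le hn htq s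

theorem greedyMass_anti (hn : 0 < n) : Antitone (I.greedyMass hn) := fun _ _ h =>
  Finset.sum_le_sum_of_subset_of_nonneg (uncovered_anti hn h) fun r _ _ => weight_nonneg r

/-- If `R` decreases by at least `(R q - O t) / t` in step `q`, whenever `t ≤ q + 1`, then the sum
of `R` is at most four times that of `O`. -/
theorem sum_le_four_mul_sum {R O : ℕ → ℝ} (hR : Antitone R) (hR0 : ∀ q, 0 ≤ R q)
    (h : ∀ q t, t ≤ q + 1 → R q ≤ O t + t * (R q - R (q + 1))) (N : ℕ) :
    ∑ q ∈ Finset.range (2 * N + 1), R q + 2 * N * R (2 * N) ≤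
      4 * ∑ t ∈ Finset.range (N + 1), O t := by
  induction N with
  | zero =>
    have h1 := h 0 0 (by omega)
    have h2 := hR0 0
    simp only [Nat.cast_zero, zero_mul, add_zero] at h1
    simp
    linarith
  | succ N ih =>
    -- Twice the sum of `h1` and `h2` turns the boundary term `2 * N * R (2 * N)` into the next one
    -- and leaves `2 * R (2 * N + 1)`, which by `h3` pays for both new summands.
    have h1 := h (2 * N) (N + 1) (by omega)
    have h2 := h (2 * N + 1) (N + 1) (by omega)
    have h3 := hR (show 2 * N + 1 ≤ 2 * N + 1 + 1 by omega)
    rw [Finset.sum_range_succ _ (N + 1), show 2 * (N + 1) + 1 = 2 * N + 1 + 1 + 1 by ring,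
      Finset.sum_range_succ, Finset.sum_range_succ, show 2 * (N + 1) = 2 * N + 1 + 1 by ring]
    push_cast at h1 h2 ⊢
    linarith

-- A payment counts the budgets `t` below it, and only these can fail to suffice.
open Classical in
theorem sum_notCoveredBy_le_scenarioCost (N : ℕ) (s : Fin m) :
    ∑ t ∈ Finset.range N, (if I.CoveredBy A t s then (0 : ℝ≥0∞) else 1) ≤
      I.scenarioCost A s := by
  refine le_iInf₂ fun k hk => ?_
  have hsum : ∑ t ∈ Finset.range N, (if I.CoveredBy A t s then (0 : ℝ≥0∞) else 1) =
      (({t ∈ Finset.range N | ¬ I.CoveredBy A t s}).card : ℝ≥0∞) := by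
    rw [Finset.card_filter, Nat.cast_sum]
    exact Finset.sum_congr rfl fun t _ => by split_ifs <;> simp_all
  rw [hsum]
  have : {t ∈ Finset.range N | ¬ I.CoveredBy A t s} ⊆ Finset.range (I.run A s k).paid := by
    intro t ht
    rw [Finset.mem_filter] at ht
    rw [Finset.mem_range]
    by_contra! hc
    exact ht.2 ⟨k, hk, hc⟩
  exact_mod_cast (Finset.card_le_card this).trans (by simp)

open Classical in
theorem sum_uncoveredMass_le_cost (N : ℕ) :
    ENNReal.ofReal (∑ t ∈ Finset.range N, I.uncoveredMass A t) ≤ I.cost A := by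
  have h : ∑ t ∈ Finset.range N, I.uncoveredMass A t =
      (∑ s, I.D s * ∑ t ∈ Finset.range N,
        (if I.CoveredBy A t s then (0 : ℝ≥0∞) else 1)).toReal := by
    simp only [Finset.mul_sum]
    rw [Finset.sum_comm, ENNReal.toReal_sum]
    · refine Finset.sum_congr rfl fun t _ => ?_
      rw [uncoveredMass, ← toReal_sum, Finset.sum_filter]
      refine congrArg _ (Finset.sum_congr rfl fun s _ => ?_)
      split_ifs <;> simp_all
    · intro t _
      refine ENNReal.sum_ne_top.mpr fun s _ => ENNReal.mul_ne_top (PMF.apply_ne_top _ _) ?_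
      split_ifs <;> simp
  rw [h]
  refine ENNReal.ofReal_toReal_le.trans (Finset.sum_le_sum fun s _ => ?_)
  gcongr
  exact sum_notCoveredBy_le_scenarioCost N s

/-- The number of queries is the number of `q` at which the scenario is still uncovered, and the
total payment is at most twice that. No `q ≥ n` is needed, so any `N ≥ n` will do. -/
theorem cost_greedyBuying_le (hn : 0 < n) {N : ℕ} (hN : n ≤ N)
    (h : ∀ s ∈ I.D.support, ∃ i, I.vec s i = true) :
    I.cost greedyBuying ≤ 2 * ENNReal.ofReal (∑ q ∈ Finset.range N, I.greedyMass hn q) := by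
  have h1 : ENNReal.ofReal (∑ q ∈ Finset.range N, I.greedyMass hn q) =
      ∑ s, I.D s * ∑ q ∈ Finset.range N, (if s ∈ I.uncovered hn q then (1 : ℝ≥0∞) else 0) := by
    rw [ENNReal.ofReal_sum_of_nonneg fun q _ =>
      show 0 ≤ I.greedyMass hn q from Finset.sum_nonneg fun s _ => weight_nonneg s]
    simp only [Finset.mul_sum]
    rw [Finset.sum_comm]
    refine Finset.sum_congr rfl fun q _ => ?_
    rw [greedyMass, ← toReal_sum,
      ENNReal.ofReal_toReal (ENNReal.sum_ne_top.mpr fun s _ => PMF.apply_ne_top _ _)]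
    simp
  rw [h1, Finset.mul_sum]
  refine Finset.sum_le_sum fun s _ => ?_
  by_cases hs : s ∈ I.D.support
  · obtain ⟨i, hi⟩ := h s hs
    obtain ⟨q, hqn, hq, hq'⟩ := exists_last_uncovered hn hs hi
    rw [mul_left_comm]
    gcongr
    refine (scenarioCost_greedyBuying_le hn hs hq hq').trans ?_
    gcongr
    calc ((q + 1 : ℕ) : ℝ≥0∞) = ∑ p ∈ Finset.range (q + 1), (1 : ℝ≥0∞) := by simp
      _ = ∑ p ∈ Finset.range (q + 1), (if s ∈ I.uncovered hn p then (1 : ℝ≥0∞) else 0) := by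
        refine Finset.sum_congr rfl fun p hp => ?_
        rw [if_pos (uncovered_anti hn (Nat.lt_succ_iff.mp (Finset.mem_range.mp hp)) hq)]
      _ ≤ _ := Finset.sum_le_sum_of_subset
        (Finset.range_subset_range.mpr (by omega))
  · rw [PMF.mem_support_iff, not_not] at hs
    simp [hs]

/-- Settles the instances with a possible scenario that no box covers: every learner, the prophet
included, pays `⊤`. -/
theorem cost_eq_top (hs : s ∈ I.D.support) (h : ∀ i, I.vec s i = false) : I.cost A = ⊤ := by
  have hrun : ∀ k, ¬ (I.run A s k).covered = true := by
    intro k hk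
    obtain ⟨_, i, _, hi, _⟩ := exists_of_run_covered hk
    rw [h i] at hi
    exact Bool.false_ne_true hi
  have h1 : I.scenarioCost A s = ⊤ := by simp [scenarioCost, hrun]
  refine ENNReal.sum_eq_top.mpr ⟨s, Finset.mem_univ s, ?_⟩
  rw [h1, ENNReal.mul_top ((PMF.mem_support_iff _ _).mp hs)]

theorem cost_greedyBuying_le_cost : I.cost greedyBuying ≤ 8 * I.cost A := by
  by_cases h : ∀ s ∈ I.D.support, ∃ i, I.vec s i = true
  · obtain ⟨s, hs⟩ := I.D.support_nonempty
    obtain ⟨i, -⟩ := h s hs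
    have hn : 0 < n := i.pos
    have hnn : ∀ q, 0 ≤ I.greedyMass hn q := fun q => Finset.sum_nonneg fun s _ => weight_nonneg s
    have hsum := sum_le_four_mul_sum (greedyMass_anti (I := I) hn) hnn
      (fun q t htq => greedyMass_le (A := A) hn htq) n
    have h0 := mul_nonneg (mul_nonneg zero_le_two n.cast_nonneg) (hnn (2 * n))
    calc I.cost greedyBuying
        ≤ 2 * ENNReal.ofReal (∑ q ∈ Finset.range (2 * n + 1), I.greedyMass hn q) :=
          cost_greedyBuying_le hn (by omega) h
      _ ≤ 2 * ENNReal.ofReal (4 * ∑ t ∈ Finset.range (n + 1), I.uncoveredMass A t) := by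
          gcongr
          linarith
      _ = 8 * ENNReal.ofReal (∑ t ∈ Finset.range (n + 1), I.uncoveredMass A t) := by
          rw [ENNReal.ofReal_mul (by norm_num), ← mul_assoc]
          norm_num
      _ ≤ 8 * I.cost A := by
          gcongr
          exact sum_uncoveredMass_le_cost _
  · push Not at h
    obtain ⟨s, hs, hv⟩ := h
    have htop : I.cost A = ⊤ := cost_eq_top hs fun i => by simpa using hv i
    rw [htop, ENNReal.mul_top (by norm_num)]
    exact le_top

end Instance

theorem greedyBuying_competitive : greedyBuying.Competitive 8 := by
  intro n m I
  rw [Instance.opt, ENNReal.mul_iInf_of_ne (by norm_num) (by norm_num)]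
  exact le_iInf fun A => Instance.cost_greedyBuying_le_cost

/-! ## Unit-cost running times -/

/-- All numbers in registers and memory have at most `B` binary digits. -/
structure Store.Bounded (σ : Store) (B : ℕ) : Prop where
  reg : ∀ x, (σ.reg x).size ≤ B
  mem : ∀ a, (σ.mem a).size ≤ B

theorem Store.Bounded.mono {σ : Store} {B C : ℕ} (h : σ.Bounded B) (hBC : B ≤ C) : σ.Bounded C :=
  ⟨fun x => (h.reg x).trans hBC, fun a => (h.mem a).trans hBC⟩

theorem Store.Bounded.setReg {σ : Store} {B : ℕ} (h : σ.Bounded B) {x a : ℕ} (ha : a.size ≤ B) :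
    (σ.setReg x a).Bounded B := by
  refine ⟨fun y => ?_, h.mem⟩
  by_cases hy : y = x
  · simpa [Store.setReg, hy] using ha
  · simpa [Store.setReg, hy] using h.reg y

theorem size_add_le {a b B : ℕ} (ha : a.size ≤ B) (hb : b.size ≤ B) : (a + b).size ≤ B + 1 := by
  rw [Nat.size_le] at *
  rw [pow_succ]
  omega

theorem size_sub_le {a B : ℕ} (b : ℕ) (ha : a.size ≤ B) : (a - b).size ≤ B :=
  (Nat.size_le_size (Nat.sub_le a b)).trans ha

/-- The registers that a program may change. -/
def Prog.writes : Prog → ℕ → Bool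
  | .const x _, y => x == y
  | .plus x _ _, y => x == y
  | .minus x _ _, y => x == y
  | .load x _, y => x == y
  | .store _ _, _ => false
  | .seq p q, y => p.writes y || q.writes y
  | .cond _ p q, y => p.writes y || q.writes y
  | .loop _ p, y => p.writes y

/-- Started in `σ`, the program `p`, which does not write to the memory, halts in `σ'` after at most
`N` instructions and tests. In particular, every instruction lengthens the numbers by at most one
binary digit. -/
structure Steps (p : Prog) (σ : Store) (N : ℕ) (σ' : Store) : Prop where
  mem : σ'.mem = σ.mem
  frame : ∀ x, p.writes x = false → σ'.reg x = σ.reg x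
  -- All `B` are allowed so that runs compose: the second part of a sequence starts with bound `B +
  -- M`. The 2 accommodates the constants below 4.
  exec : ∀ B, 2 ≤ B → σ.Bounded B →
    σ'.Bounded (B + N) ∧ ∃ k ≤ N * (1 + 2 * (B + N)), p.Exec σ k σ'

namespace Steps

variable {p q : Prog} {σ σ' σ'' : Store} {M N : ℕ}

theorem mono (h : Steps p σ M σ') (hMN : M ≤ N) : Steps p σ N σ' := by
  refine ⟨h.mem, h.frame, fun B hB hσ => ?_⟩
  obtain ⟨h1, k, hk, h2⟩ := h.exec B hB hσ
  exact ⟨h1.mono (by omega), k, hk.trans (by gcongr), h2⟩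

theorem setReg_frame {x a : ℕ} {y : ℕ} (h : (x == y) = false) :
    (σ.setReg x a).reg y = σ.reg y := by
  have : y ≠ x := fun e => by simp [e] at h
  simp [Store.setReg, this]

theorem const (x : ℕ) {a : ℕ} (ha : a < 4) (σ : Store) :
    Steps (.const x a) σ 1 (σ.setReg x a) := by
  refine ⟨rfl, fun y => setReg_frame, fun B hB hσ => ?_⟩
  have : a.size ≤ 2 := Nat.size_le.mpr (by simpa using ha)
  exact ⟨(hσ.mono (by omega)).setReg (by omega), _, by omega, .const x a σ⟩

theorem plus (x y z : ℕ) (σ : Store) :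
    Steps (.plus x y z) σ 1 (σ.setReg x (σ.reg y + σ.reg z)) := by
  refine ⟨rfl, fun y => setReg_frame, fun B hB hσ => ?_⟩
  have h1 := hσ.reg y
  have h2 := hσ.reg z
  exact ⟨(hσ.mono (by omega)).setReg (size_add_le h1 h2), _, by omega, .plus x y z σ⟩

theorem minus (x y z : ℕ) (σ : Store) :
    Steps (.minus x y z) σ 1 (σ.setReg x (σ.reg y - σ.reg z)) := by
  refine ⟨rfl, fun y => setReg_frame, fun B hB hσ => ?_⟩
  have h1 := hσ.reg y
  have h2 := hσ.reg z
  exact ⟨(hσ.mono (by omega)).setReg ((size_sub_le _ h1).trans (by omega)), _, by omega,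
    .minus x y z σ⟩

theorem load (x y : ℕ) (σ : Store) :
    Steps (.load x y) σ 1 (σ.setReg x (σ.mem (σ.reg y))) := by
  refine ⟨rfl, fun y => setReg_frame, fun B hB hσ => ?_⟩
  have h1 := hσ.reg y
  have h2 := hσ.mem (σ.reg y)
  exact ⟨(hσ.mono (by omega)).setReg (by omega), _, by omega, .load x y σ⟩

theorem cost_add_le {k l B : ℕ} (hk : k ≤ M * (1 + 2 * (B + M)))
    (hl : l ≤ N * (1 + 2 * (B + M + N))) : k + l ≤ (M + N) * (1 + 2 * (B + (M + N))) := by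
  have : M * (1 + 2 * (B + M)) ≤ M * (1 + 2 * (B + M + N)) := Nat.mul_le_mul_left _ (by omega)
  calc k + l ≤ M * (1 + 2 * (B + M + N)) + N * (1 + 2 * (B + M + N)) := by omega
    _ = (M + N) * (1 + 2 * (B + (M + N))) := by ring

theorem seq (hp : Steps p σ M σ') (hq : Steps q σ' N σ'') : Steps (.seq p q) σ (M + N) σ'' := by
  refine ⟨hq.mem.trans hp.mem, fun x hx => ?_, fun B hB hσ => ?_⟩
  · simp only [Prog.writes, Bool.or_eq_false_iff] at hx
    rw [hq.frame x hx.2, hp.frame x hx.1]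
  · obtain ⟨h1, k, hk, h2⟩ := hp.exec B hB hσ
    obtain ⟨h3, l, hl, h4⟩ := hq.exec (B + M) (by omega) h1
    exact ⟨h3.mono (by omega), k + l, cost_add_le hk hl, .seq p q k l σ σ' σ'' h2 h4⟩

theorem cost_succ_le {k s B : ℕ} (hs : s ≤ B) (hk : k ≤ N * (1 + 2 * (B + N))) :
    1 + s + k ≤ (N + 1) * (1 + 2 * (B + (N + 1))) := by
  have := cost_add_le (M := 1) (k := 1 + s) (B := B) (by omega)
    (hk.trans (show _ ≤ N * (1 + 2 * (B + 1 + N)) by gcongr; omega))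
  rwa [add_comm 1 N] at this

theorem condTrue {x : ℕ} (q : Prog) (hx : σ.reg x ≠ 0) (hp : Steps p σ N σ') :
    Steps (.cond x p q) σ (N + 1) σ' := by
  refine ⟨hp.mem, fun y hy => ?_, fun B hB hσ => ?_⟩
  · simp only [Prog.writes, Bool.or_eq_false_iff] at hy
    exact hp.frame y hy.1
  · obtain ⟨h1, k, hk, h2⟩ := hp.exec B hB hσ
    exact ⟨h1.mono (by omega), _, cost_succ_le (hσ.reg x) hk, .condTrue x p q k σ σ' hx h2⟩

theorem condFalse {x : ℕ} (p : Prog) (hx : σ.reg x = 0) (hq : Steps q σ N σ') :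
    Steps (.cond x p q) σ (N + 1) σ' := by
  refine ⟨hq.mem, fun y hy => ?_, fun B hB hσ => ?_⟩
  · simp only [Prog.writes, Bool.or_eq_false_iff] at hy
    exact hq.frame y hy.2
  · obtain ⟨h1, k, hk, h2⟩ := hq.exec B hB hσ
    exact ⟨h1.mono (by omega), _, cost_succ_le (Nat.zero_le B) hk,
      .condFalse x p q k σ σ' hx h2⟩

theorem loopDone {x : ℕ} (p : Prog) (hx : σ.reg x = 0) : Steps (.loop x p) σ 1 σ :=
  ⟨rfl, fun _ _ => rfl, fun _ _ hσ => ⟨hσ.mono (by omega), 1, by omega, .loopDone x p σ hx⟩⟩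

theorem loopStep {x : ℕ} (hx : σ.reg x ≠ 0) (hp : Steps p σ M σ')
    (hl : Steps (.loop x p) σ' N σ'') : Steps (.loop x p) σ (M + N + 1) σ'' := by
  refine ⟨hl.mem.trans hp.mem, fun y hy => ?_, fun B hB hσ => ?_⟩
  · rw [hl.frame y hy, hp.frame y hy]
  · obtain ⟨h1, k, hk, h2⟩ := hp.exec B hB hσ
    obtain ⟨h3, l, hl, h4⟩ := hl.exec (B + M) (by omega) h1
    refine ⟨h3.mono (by omega), _, ?_, .loopStep x p k l σ σ' σ'' hx h2 h4⟩
    rw [add_assoc (1 + _) k l]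
    exact cost_succ_le (hσ.reg x) (cost_add_le hk hl)

end Steps

/-! ## Programs without loops -/

/-- Programs without loops and without writes to the memory, with small constants. -/
def Prog.Simple : Prog → Prop
  | .const _ a => a < 4
  | .plus _ _ _ => True
  | .minus _ _ _ => True
  | .load _ _ => True
  | .store _ _ => False
  | .seq p q => p.Simple ∧ q.Simple
  | .cond _ p q => p.Simple ∧ q.Simple
  | .loop _ _ => False

/-- The result of a simple program. -/
def Prog.eval : Prog → Store → Store
  | .const x a, σ => σ.setReg x a
  | .plus x y z, σ => σ.setReg x (σ.reg y + σ.reg z)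
  | .minus x y z, σ => σ.setReg x (σ.reg y - σ.reg z)
  | .load x y, σ => σ.setReg x (σ.mem (σ.reg y))
  | .store _ _, σ => σ
  | .seq p q, σ => q.eval (p.eval σ)
  | .cond x p q, σ => if σ.reg x ≠ 0 then p.eval σ else q.eval σ
  | .loop _ _, σ => σ

/-- The number of steps of a simple program. -/
def Prog.len : Prog → ℕ
  | .seq p q => p.len + q.len
  | .cond _ p q => max p.len q.len + 1
  | _ => 1

theorem Prog.Simple.steps {p : Prog} (h : p.Simple) (σ : Store) : Steps p σ p.len (p.eval σ) := by
  induction p generalizing σ with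
  | const x a => exact .const x h σ
  | plus x y z => exact .plus x y z σ
  | minus x y z => exact .minus x y z σ
  | load x y => exact .load x y σ
  | store x y => exact h.elim
  | seq p q hp hq => exact (hp h.1 σ).seq (hq h.2 _)
  | cond x p q hp hq =>
    by_cases hx : σ.reg x = 0
    · rw [eval, if_neg (by simpa using hx)]
      exact (Steps.condFalse p hx (hq h.2 σ)).mono (by simp [len])
    · rw [eval, if_pos hx]
      exact (Steps.condTrue q hx (hp h.1 σ)).mono (by simp [len])
  | loop x p => exact h.elim

/-! ## The program for GreedyBuying

Register 0 holds the result, 1 the number one, 2 and 3 the numbers of boxes and of scenarios, 4 the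
address of the observations, 17 the number zero. -/

/-- Process the observation at address `r6` for the scenario number `r10`, described at address
`r12`: `r13` becomes 0 if the scenario is not consistent with it. Then `r6` is the address of the
next observation, and `r7` its first entry. -/
def scanBody : Prog :=
  .seq (.minus 5 7 1) <|
  .seq (.cond 5
    (.seq (.plus 6 6 1) <| .seq (.load 16 6) <| .seq (.plus 6 6 1) <|
      .seq (.plus 16 16 12) <| .seq (.plus 16 16 1) <| .load 16 16)
    (.seq (.plus 6 6 1) <| .seq (.plus 6 6 1) <| .seq (.plus 16 6 10) <|
      .seq (.load 16 16) <| .seq (.minus 16 1 16) <| .plus 6 6 3)) <|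
  .seq (.minus 13 13 16) <| .load 7 6

/-- Prepare to process the observations for a scenario. -/
def scanInit : Prog := .seq (.const 13 1) <| .seq (.plus 6 4 17) <| .load 7 6

/-- If the scenario is consistent, and covered by box `r8`, then add its weight to `r14`. Then go on
to the next scenario; `r11` is the number of scenarios left. -/
def scenarioEnd : Prog :=
  .seq (.plus 5 12 1) <| .seq (.plus 5 5 8) <| .seq (.load 5 5) <|
  -- Register 5 is scratch, so `.const 5 0` serves as an empty branch.
  .seq (.cond 13 (.cond 5 (.seq (.load 16 12) <| .plus 14 14 16) (.const 5 0)) (.const 5 0)) <|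
  .seq (.plus 12 12 2) <| .seq (.plus 12 12 1) <| .seq (.plus 10 10 1) <| .minus 11 11 1

/-- Process a scenario. -/
def scenarioBody : Prog := .seq scanInit <| .seq (.loop 7 scanBody) scenarioEnd

/-- Prepare to process the scenarios for a box. -/
def scenarioInit : Prog :=
  .seq (.const 14 0) <| .seq (.const 10 0) <| .seq (.const 12 2) <| .plus 11 3 17

/-- Compare the weight `r14` of box `r8` with the best weight so far (plus 1), `r15`. Then go on to
the next box; `r9` is the number of boxes left. -/
def boxEnd : Prog :=
  -- The shift by 1 lets the first box beat the initial 0 even with weight 0. Register 8 is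
  -- increased before it is copied to register 0, which yields the action code `i + 1`.
  .seq (.plus 14 14 1) <| .seq (.minus 5 14 15) <| .seq (.plus 8 8 1) <| .seq (.minus 9 9 1) <|
  .cond 5 (.seq (.plus 15 14 17) <| .plus 0 8 17) (.const 5 0)

/-- Process a box. -/
def boxBody : Prog := .seq scenarioInit <| .seq (.loop 11 scenarioBody) boxEnd

/-- Prepare to process the boxes. -/
def boxInit : Prog := .seq (.const 8 0) <| .seq (.plus 9 2 17) <| .const 15 0

/-- Count a query in `r10`. -/
def queryBody : Prog :=
  .seq (.plus 10 10 1) <| .seq (.plus 6 6 1) <| .seq (.plus 6 6 1) <|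
  .seq (.load 7 6) <| .minus 5 7 1

/-- Prepare to count the queries. -/
def queryInit : Prog :=
  .seq (.plus 6 4 17) <| .seq (.const 10 0) <| .seq (.load 7 6) <| .minus 5 7 1

/-- Let `r5` be the number of queries to be made before the next signal is bought. -/
def queryEnd : Prog :=
  .seq (.cond 7 (.seq (.plus 6 6 1) <| .load 13 6) (.const 13 0)) <| .minus 5 13 10

/-- Read the numbers of boxes and scenarios. -/
def readInit : Prog :=
  .seq (.const 1 1) <| .seq (.load 2 0) <| .seq (.load 3 1) <| .seq (.const 4 2) <| .plus 11 3 17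

/-- Skip a scenario. -/
def readBody : Prog := .seq (.plus 4 4 2) <| .seq (.plus 4 4 1) <| .minus 11 11 1

/-- The program for GreedyBuying. -/
def greedyProg : Prog :=
  .seq readInit <| .seq (.loop 11 readBody) <|
  .seq queryInit <| .seq (.loop 5 queryBody) <| .seq queryEnd <|
  .cond 5 (.seq boxInit <| .loop 9 boxBody) (.const 5 0)

/-! ## Correctness of the program -/

/-- The memory contains the list `l` from the address `p` on, and zeros after it. -/
def MemAt (mem : ℕ → ℕ) (p : ℕ) (l : List ℕ) : Prop := ∀ j, mem (p + j) = l.getD j 0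

theorem MemAt.append_right {mem : ℕ → ℕ} {p : ℕ} {l l' : List ℕ} (h : MemAt mem p (l ++ l')) :
    MemAt mem (p + l.length) l' := fun j => by
  rw [add_assoc, h, List.getD_append_right _ _ _ _ (by omega)]
  simp

theorem MemAt.append_left {mem : ℕ → ℕ} {p : ℕ} {l l' : List ℕ} (h : MemAt mem p (l ++ l')) {j : ℕ}
    (hj : j < l.length) : mem (p + j) = l[j] := by
  rw [h, List.getD_append _ _ _ _ hj, List.getD_eq_getElem _ _ hj]

variable {n m : ℕ}

/-- The memory contains the input of a decision. -/
structure Holds (mem : ℕ → ℕ) (X : MSSC n m) (W : Fin m → ℕ) (h : List (Event n m)) : Prop where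
  boxes : mem 0 = n
  scenarios : mem 1 = m
  weight : ∀ s : Fin m, mem (2 + s * (n + 1)) = W s
  vec : ∀ (s : Fin m) (i : Fin n), mem (2 + s * (n + 1) + 1 + i) = (X.vec s i).toNat
  events : MemAt mem (2 + m * (n + 1)) (h.flatMap Event.code)

theorem memAt_flatten {mem : ℕ → ℕ} {w : ℕ} {R : List ℕ} {L : List (List ℕ)}
    (hL : ∀ l ∈ L, l.length = w) {p : ℕ} (h : MemAt mem p (L.flatten ++ R)) :
    (∀ (s : ℕ) (hs : s < L.length) (j : ℕ) (hj : j < L[s].length),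
      mem (p + s * w + j) = L[s][j]) ∧ MemAt mem (p + L.length * w) R := by
  induction L generalizing p with
  | nil => exact ⟨fun s hs => absurd hs (by simp), by simpa using h⟩
  | cons l L ih =>
    have hl : l.length = w := hL l (by simp)
    rw [List.flatten_cons, List.append_assoc] at h
    obtain ⟨h1, h2⟩ := ih (fun l hl => hL l (by simp [hl])) h.append_right
    rw [hl] at h1 h2
    refine ⟨fun s hs j hj => ?_, ?_⟩
    · cases s with
      | zero => simpa using h.append_left hj
      | succ s =>
        have := h1 s (by simpa using hs) j hj
        rw [show p + (s + 1) * w + j = p + w + s * w + j by ring]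
        exact this
    · rw [show p + (l :: L).length * w = p + w + L.length * w by
        rw [List.length_cons]; ring]
      exact h2

theorem holds_inputStore (X : MSSC n m) (W : Fin m → ℕ) (h : List (Event n m)) :
    Holds (inputStore (inputCode X W h)).mem X W h := by
  have h0 : MemAt (inputStore (inputCode X W h)).mem 0 ([n, m] ++
      ((List.ofFn fun s => W s :: List.ofFn fun i => (X.vec s i).toNat).flatten ++
        h.flatMap Event.code)) := fun j => by rw [zero_add]; rfl
  obtain ⟨h1, h2⟩ := memAt_flatten (w := n + 1) (by simp [List.mem_ofFn]) h0.append_right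
  simp only [List.length_cons, List.length_nil, zero_add, List.length_ofFn, List.getElem_ofFn,
    Nat.reduceAdd] at h1 h2
  refine ⟨rfl, rfl, fun s => ?_, fun s i => ?_, h2⟩
  · simpa using h1 s s.2 0 (by simp)
  · have := h1 s s.2 (i + 1) (by simp)
    rw [show 2 + (s : ℕ) * (n + 1) + 1 + i = 2 + s * (n + 1) + (i + 1) by ring, this]
    simp

/-- Register 13 starts with an arbitrary flag, not just 1, so that in the induction the first
observation is absorbed into the flag. -/
theorem scan_steps {X : MSSC n m} {s : Fin m} (h : List (Event n m)) {σ : Store}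
    (h1 : σ.reg 1 = 1) (h3 : σ.reg 3 = m) (h7 : σ.reg 7 = σ.mem (σ.reg 6)) (h10 : σ.reg 10 = s)
    (h13 : σ.reg 13 ≤ 1) (hv : ∀ i : Fin n, σ.mem (σ.reg 12 + 1 + i) = (X.vec s i).toNat)
    (he : MemAt σ.mem (σ.reg 6) (h.flatMap Event.code)) :
    ∃ σ', Steps (.loop 7 scanBody) σ (20 * h.length + 1) σ' ∧
      σ'.reg 13 = if s ∈ X.alive h then σ.reg 13 else 0 := by
  induction h generalizing σ with
  | nil =>
    -- Each observation code starts with 1 or 2, so the zero behind the input ends the loop.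
    have := he 0
    refine ⟨σ, .loopDone _ (by simpa [h7] using this), by simp [MSSC.alive]⟩
  | cons e h ih =>
    rw [List.flatMap_cons] at he
    have hS : scanBody.Simple := by simp [scanBody, Prog.Simple]
    have hst := hS.steps σ
    have hlen : scanBody.len ≤ 12 := by decide
    have key : σ.reg 7 ≠ 0 ∧
        (scanBody.eval σ).reg 7 = (scanBody.eval σ).mem ((scanBody.eval σ).reg 6) ∧
        (scanBody.eval σ).reg 6 = σ.reg 6 + e.code.length ∧
        (scanBody.eval σ).reg 13 ≤ 1 ∧
        (if s ∈ X.alive (e :: h) then σ.reg 13 else 0) =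
          if s ∈ X.alive h then (scanBody.eval σ).reg 13 else 0 := by
      cases e with
      | signal y S c =>
        have ht := he.append_left (j := 0) (by simp [Event.code])
        have hb := he.append_left (j := 2 + s) (by simp [Event.code, add_comm 2])
        simp [Event.code, ← add_assoc, List.getElem_cons] at ht hb
        have h17 : σ.reg 7 = 1 := h7.trans ht
        simp [scanBody, Prog.eval, Store.setReg, Function.update, h1, h3, h10, h17, hb,
          MSSC.alive, Event.code]
        refine ⟨by omega, by omega, ?_⟩
        by_cases hS : s ∈ S <;> simp [hS]
        omega
      | miss i =>
        have ht := he.append_left (j := 0) (by simp [Event.code])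
        have hb := he.append_left (j := 1) (by simp [Event.code])
        simp [Event.code] at ht hb
        have h17 : σ.reg 7 = 2 := h7.trans ht
        have hv' := hv i
        simp [scanBody, Prog.eval, Store.setReg, Function.update, h1, h17, hb, MSSC.alive,
          Event.code]
        rw [show (i : ℕ) + σ.reg 12 + 1 = σ.reg 12 + 1 + i by ring, hv']
        refine ⟨by omega, ?_⟩
        cases X.vec s i <;> simp
        omega
    obtain ⟨k1, k2, k3, k4, k5⟩ := key
    obtain ⟨σ', hσ', h'⟩ := ih (σ := scanBody.eval σ) ((hst.frame 1 rfl).trans h1)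
      ((hst.frame 3 rfl).trans h3) k2 ((hst.frame 10 rfl).trans h10) k4
      (by rw [hst.mem, hst.frame 12 rfl]; exact hv)
      (by rw [hst.mem, k3]; exact he.append_right)
    refine ⟨σ', (Steps.loopStep k1 hst hσ').mono ?_, by rw [h', k5]⟩
    simp only [List.length_cons]
    omega

/-- The weight of the scenario number `r` if it is consistent with `h` and covered by box `i`. -/
def scenarioWeight (X : MSSC n m) (W : Fin m → ℕ) (h : List (Event n m)) (i : Fin n) (r : ℕ) : ℕ :=
  if hr : r < m then
    if (⟨r, hr⟩ : Fin m) ∈ X.alive h ∧ X.vec ⟨r, hr⟩ i = true then W ⟨r, hr⟩ else 0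
  else 0

theorem scenario_steps {X : MSSC n m} {W : Fin m → ℕ} {h : List (Event n m)} (i : Fin n)
    (c : ℕ) {s : ℕ} {σ : Store} (hc : s + c = m) (h1 : σ.reg 1 = 1) (h2 : σ.reg 2 = n)
    (h3 : σ.reg 3 = m) (h4 : σ.reg 4 = 2 + m * (n + 1)) (h17 : σ.reg 17 = 0) (h8 : σ.reg 8 = i)
    (h10 : σ.reg 10 = s) (h11 : σ.reg 11 = c) (h12 : σ.reg 12 = 2 + s * (n + 1))
    (hm : Holds σ.mem X W h) :
    ∃ σ', Steps (.loop 11 scenarioBody) σ (c * (20 * h.length + 30) + 1) σ' ∧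
      σ'.reg 14 = σ.reg 14 + ∑ r ∈ Finset.Ico s m, scenarioWeight X W h i r := by
  induction c generalizing s σ with
  | zero => exact ⟨σ, (Steps.loopDone _ h11).mono (by omega), by simp [show s = m by omega]⟩
  | succ c ih =>
    have hsm : s < m := by omega
    have hs1 : scanInit.Simple := by simp [scanInit, Prog.Simple]
    have st1 := hs1.steps σ
    set σ1 := scanInit.eval σ with hσ1
    have h1_13 : σ1.reg 13 = 1 := by
      simp [hσ1, scanInit, Prog.eval, Store.setReg, Function.update]
    have h1_6 : σ1.reg 6 = 2 + m * (n + 1) := by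
      simp [hσ1, scanInit, Prog.eval, Store.setReg, Function.update, h4, h17]
    have h1_7 : σ1.reg 7 = σ1.mem (σ1.reg 6) := by
      simp [hσ1, scanInit, Prog.eval, Store.setReg, Function.update]
    obtain ⟨σ2, st2, h2_13⟩ := scan_steps (X := X) (s := ⟨s, hsm⟩) h (σ := σ1)
      ((st1.frame 1 rfl).trans h1) ((st1.frame 3 rfl).trans h3) h1_7
      ((st1.frame 10 rfl).trans h10) h1_13.le
      (fun j => by rw [st1.mem, st1.frame 12 rfl, h12]; exact hm.vec ⟨s, hsm⟩ j)
      (by rw [st1.mem, h1_6]; exact hm.events)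
    have hs3 : scenarioEnd.Simple := by simp [scenarioEnd, Prog.Simple]
    have st3 := hs3.steps σ2
    set σ3 := scenarioEnd.eval σ2 with hσ3
    have f : ∀ x, (Prog.seq scanInit (.loop 7 scanBody)).writes x = false →
        σ2.reg x = σ.reg x := (st1.seq st2).frame
    have hmem : σ2.mem = σ.mem := (st1.seq st2).mem
    have st := st1.seq (st2.seq st3)
    have hv := hm.vec ⟨s, hsm⟩ i
    have hw := hm.weight ⟨s, hsm⟩
    simp only at hv hw
    have h3_14 : σ3.reg 14 = σ.reg 14 + scenarioWeight X W h i s := by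
      simp [hσ3, scenarioEnd, Prog.eval, Store.setReg, Function.update, f 1 rfl, f 12 rfl, f 8 rfl,
        h1, h12, h8, hmem, hv, hw, h2_13, h1_13, f 14 rfl, apply_ite Store.reg, ite_apply]
      rw [scenarioWeight, dif_pos hsm]
      cases X.vec ⟨s, hsm⟩ i <;> simp
      split_ifs <;> simp
    have h3_12 : σ3.reg 12 = 2 + (s + 1) * (n + 1) := by
      simp [hσ3, scenarioEnd, Prog.eval, Store.setReg, Function.update, apply_ite Store.reg,
        ite_apply, f 12 rfl, f 1 rfl, f 2 rfl, h1, h2, h12]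
      ring
    have h3_10 : σ3.reg 10 = s + 1 := by
      simp [hσ3, scenarioEnd, Prog.eval, Store.setReg, Function.update, apply_ite Store.reg,
        ite_apply, f 1 rfl, f 10 rfl, h1, h10]
    have h3_11 : σ3.reg 11 = c := by
      simp [hσ3, scenarioEnd, Prog.eval, Store.setReg, Function.update, apply_ite Store.reg,
        ite_apply, f 1 rfl, f 11 rfl, h1, h11]
    obtain ⟨σ', st', h'⟩ := ih (s := s + 1) (σ := σ3) (by omega) ((st.frame 1 rfl).trans h1)
      ((st.frame 2 rfl).trans h2) ((st.frame 3 rfl).trans h3) ((st.frame 4 rfl).trans h4)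
      ((st.frame 17 rfl).trans h17) ((st.frame 8 rfl).trans h8) h3_10 h3_11 h3_12
      (by rw [st.mem]; exact hm)
    refine ⟨σ', (Steps.loopStep (by omega) st st').mono ?_, ?_⟩
    · have e1 : scanInit.len = 3 := rfl
      have e3 : scenarioEnd.len = 11 := rfl
      rw [e1, e3, add_mul]
      omega
    · rw [h', h3_14, Finset.sum_eq_sum_Ico_succ_bot hsm, add_assoc]

/-- The weight of the scenarios that are consistent with `h` and covered by box number `i`. -/
def boxWeight (X : MSSC n m) (W : Fin m → ℕ) (h : List (Event n m)) (i : ℕ) : ℕ :=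
  if hi : i < n then ∑ r ∈ Finset.range m, scenarioWeight X W h ⟨i, hi⟩ r else 0

theorem box_steps {X : MSSC n m} {W : Fin m → ℕ} {h : List (Event n m)}
    (c : ℕ) {i : ℕ} {σ : Store} (hc : i + c = n) (h1 : σ.reg 1 = 1) (h2 : σ.reg 2 = n)
    (h3 : σ.reg 3 = m) (h4 : σ.reg 4 = 2 + m * (n + 1)) (h17 : σ.reg 17 = 0) (h8 : σ.reg 8 = i)
    (h9 : σ.reg 9 = c)
    (h0 : σ.reg 0 = if i = 0 then 0 else firstMax (boxWeight X W h) i + 1)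
    (h15 : σ.reg 15 = if i = 0 then 0 else boxWeight X W h (firstMax (boxWeight X W h) i) + 1)
    (hm : Holds σ.mem X W h) :
    ∃ σ', Steps (.loop 9 boxBody) σ (c * (m * (20 * h.length + 30) + 20) + 1) σ' ∧
      σ'.reg 0 = if n = 0 then 0 else firstMax (boxWeight X W h) n + 1 := by
  induction c generalizing i σ with
  | zero =>
    obtain rfl : i = n := by omega
    exact ⟨σ, (Steps.loopDone _ h9).mono (by omega), h0⟩
  | succ c ih =>
    have hin : i < n := by omega
    have hs1 : scenarioInit.Simple := by simp [scenarioInit, Prog.Simple]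
    have st1 := hs1.steps σ
    set σ1 := scenarioInit.eval σ with hσ1
    obtain ⟨σ2, st2, h2_14⟩ := scenario_steps (X := X) (W := W) (h := h) ⟨i, hin⟩ m (s := 0) (σ := σ1)
      (by omega) ((st1.frame 1 rfl).trans h1) ((st1.frame 2 rfl).trans h2)
      ((st1.frame 3 rfl).trans h3) ((st1.frame 4 rfl).trans h4) ((st1.frame 17 rfl).trans h17)
      ((st1.frame 8 rfl).trans h8)
      (by simp [hσ1, scenarioInit, Prog.eval, Store.setReg, Function.update])
      (by simp [hσ1, scenarioInit, Prog.eval, Store.setReg, Function.update, h3, h17])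
      (by simp [hσ1, scenarioInit, Prog.eval, Store.setReg, Function.update])
      (by rw [st1.mem]; exact hm)
    have h1_14 : σ1.reg 14 = 0 := by
      simp [hσ1, scenarioInit, Prog.eval, Store.setReg, Function.update]
    have hw : σ2.reg 14 = boxWeight X W h i := by
      rw [h2_14, h1_14, boxWeight, dif_pos hin, zero_add, Finset.range_eq_Ico]
    have hs3 : boxEnd.Simple := by simp [boxEnd, Prog.Simple]
    have st3 := hs3.steps σ2
    set σ3 := boxEnd.eval σ2 with hσ3
    have f : ∀ x, (Prog.seq scenarioInit (.loop 11 scenarioBody)).writes x = false →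
        σ2.reg x = σ.reg x := (st1.seq st2).frame
    have st := st1.seq (st2.seq st3)
    have h3_8 : σ3.reg 8 = i + 1 := by
      simp [hσ3, boxEnd, Prog.eval, Store.setReg, Function.update, apply_ite Store.reg, ite_apply,
        f 1 rfl, f 8 rfl, h1, h8]
    have h3_9 : σ3.reg 9 = c := by
      simp [hσ3, boxEnd, Prog.eval, Store.setReg, Function.update, apply_ite Store.reg, ite_apply,
        f 1 rfl, f 9 rfl, h1, h9]
    have h3_0 : σ3.reg 0 = firstMax (boxWeight X W h) (i + 1) + 1 := by
      simp [hσ3, boxEnd, Prog.eval, Store.setReg, Function.update, f 1 rfl, f 8 rfl, f 17 rfl,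
        f 15 rfl, f 0 rfl, h1, h8, h15, h17, h0, hw, firstMax, apply_ite Store.reg, ite_apply]
      rcases Nat.eq_zero_or_pos i with rfl | hi
      · simp [firstMax]
      · split_ifs <;> omega
    have h3_15 : σ3.reg 15 = boxWeight X W h (firstMax (boxWeight X W h) (i + 1)) + 1 := by
      simp [hσ3, boxEnd, Prog.eval, Store.setReg, Function.update, f 1 rfl, f 8 rfl, f 17 rfl,
        f 15 rfl, h1, h8, h15, h17, hw, firstMax, apply_ite Store.reg, ite_apply]
      rcases Nat.eq_zero_or_pos i with rfl | hi
      · simp [firstMax]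
      · split_ifs <;> omega
    obtain ⟨σ', st', h'⟩ := ih (i := i + 1) (σ := σ3) (by omega) ((st.frame 1 rfl).trans h1)
      ((st.frame 2 rfl).trans h2) ((st.frame 3 rfl).trans h3) ((st.frame 4 rfl).trans h4)
      ((st.frame 17 rfl).trans h17) h3_8 h3_9 (by simpa using h3_0) (by simpa using h3_15)
      (by rw [st.mem]; exact hm)
    refine ⟨σ', (Steps.loopStep (by omega) st st').mono ?_, h'⟩
    have e1 : scenarioInit.len = 4 := rfl
    have e3 : boxEnd.len = 7 := rfl
    rw [e1, e3, add_mul _ 1]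
    omega

/-- With truncated subtraction, `σ.reg 7 - 1` is nonzero only at a miss (code 2), so the loop stops
at the latest signal (code 1) or at the end of the input (0). -/
theorem query_steps (h : List (Event n m)) {σ : Store} (h1 : σ.reg 1 = 1)
    (h7 : σ.reg 7 = σ.mem (σ.reg 6)) (h5 : σ.reg 5 = σ.reg 7 - 1)
    (he : MemAt σ.mem (σ.reg 6) (h.flatMap Event.code)) :
    ∃ σ', Steps (.loop 5 queryBody) σ (10 * h.length + 1) σ' ∧
      σ'.reg 10 = σ.reg 10 + queriesSinceSignal h ∧
      currentPrice h = if σ'.reg 7 = 0 then 0 else σ.mem (σ'.reg 6 + 1) := by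
  induction h generalizing σ with
  | nil =>
    have := he 0
    simp at this
    exact ⟨σ, (Steps.loopDone _ (by omega)).mono (by simp), by simp [queriesSinceSignal],
      by simp [h7, this, currentPrice]⟩
  | cons e h ih =>
    rw [List.flatMap_cons] at he
    cases e with
    | signal y S c =>
      have ht := he.append_left (j := 0) (by simp [Event.code])
      have hb := he.append_left (j := 1) (by simp [Event.code])
      simp [Event.code] at ht hb
      exact ⟨σ, (Steps.loopDone _ (by omega)).mono (by simp), by simp [queriesSinceSignal],
        by simp [h7, ht, hb, currentPrice]⟩
    | miss i =>
      have ht := he.append_left (j := 0) (by simp [Event.code])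
      simp [Event.code] at ht
      have hs : queryBody.Simple := by simp [queryBody, Prog.Simple]
      have st := hs.steps σ
      obtain ⟨σ', st', h10, hp⟩ := ih (σ := queryBody.eval σ) ((st.frame 1 rfl).trans h1)
        (by simp [queryBody, Prog.eval, Store.setReg, Function.update, h1])
        (by simp [queryBody, Prog.eval, Store.setReg, Function.update, h1])
        (by
          have := he.append_right
          simpa [queryBody, Prog.eval, Store.setReg, Function.update, h1, Event.code,
            add_assoc] using this)
      refine ⟨σ', (Steps.loopStep (by omega) st st').mono ?_, ?_, by rw [st.mem] at hp; exact hp⟩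
      · have : queryBody.len = 5 := rfl
        rw [this, List.length_cons]
        omega
      · rw [h10]
        simp [queryBody, Prog.eval, Store.setReg, Function.update, h1, queriesSinceSignal]
        omega

theorem read_steps (c : ℕ) {σ : Store} (h1 : σ.reg 1 = 1) (h11 : σ.reg 11 = c) :
    ∃ σ', Steps (.loop 11 readBody) σ (c * 4 + 1) σ' ∧
      σ'.reg 4 = σ.reg 4 + c * (σ.reg 2 + 1) := by
  induction c generalizing σ with
  | zero => exact ⟨σ, (Steps.loopDone _ h11).mono (by omega), by simp⟩
  | succ c ih =>
    have hs : readBody.Simple := by simp [readBody, Prog.Simple]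
    have st := hs.steps σ
    obtain ⟨σ', st', h4⟩ := ih (σ := readBody.eval σ) ((st.frame 1 rfl).trans h1)
      (by simp [readBody, Prog.eval, Store.setReg, Function.update, h1, h11])
    refine ⟨σ', (Steps.loopStep (by omega) st st').mono ?_, ?_⟩
    · have : readBody.len = 3 := rfl
      omega
    · rw [h4]
      simp [readBody, Prog.eval, Store.setReg, Function.update, h1]
      ring

theorem greedyProg_steps {X : MSSC n m} {W : Fin m → ℕ} {h : List (Event n m)} {σ : Store}
    (hm : Holds σ.mem X W h) (h0 : ∀ x, σ.reg x = 0) :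
    ∃ σ', Steps greedyProg σ
        (n * (m * (20 * h.length + 30) + 20) + m * 4 + 10 * h.length + 50) σ' ∧
      σ'.reg 0 = if queriesSinceSignal h < currentPrice h then
        (if n = 0 then 0 else firstMax (boxWeight X W h) n + 1) else 0 := by
  have hs1 : readInit.Simple := by simp [readInit, Prog.Simple]
  have st1 := hs1.steps σ
  set σ1 := readInit.eval σ with hσ1
  have h1_1 : σ1.reg 1 = 1 := by
    simp [hσ1, readInit, Prog.eval, Store.setReg, Function.update]
  have h1_2 : σ1.reg 2 = n := by
    simp [hσ1, readInit, Prog.eval, Store.setReg, Function.update, h0, hm.boxes]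
  have h1_3 : σ1.reg 3 = m := by
    simp [hσ1, readInit, Prog.eval, Store.setReg, Function.update, hm.scenarios]
  have h1_4 : σ1.reg 4 = 2 := by
    simp [hσ1, readInit, Prog.eval, Store.setReg, Function.update]
  have h1_11 : σ1.reg 11 = m := by
    simp [hσ1, readInit, Prog.eval, Store.setReg, Function.update, h0, hm.scenarios]
  obtain ⟨σ2, st2, h2_4⟩ := read_steps m h1_1 h1_11
  rw [h1_4, h1_2] at h2_4
  have hs3 : queryInit.Simple := by simp [queryInit, Prog.Simple]
  have st3 := hs3.steps σ2
  set σ3 := queryInit.eval σ2 with hσ3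
  have st13 := st1.seq (st2.seq st3)
  have h2_17 : σ2.reg 17 = 0 := ((st1.seq st2).frame 17 rfl).trans (h0 17)
  have h2_1 : σ2.reg 1 = 1 := (st2.frame 1 rfl).trans h1_1
  have h3_6 : σ3.reg 6 = 2 + m * (n + 1) := by
    simp [hσ3, queryInit, Prog.eval, Store.setReg, Function.update, h2_4, h2_17]
  have h3_10 : σ3.reg 10 = 0 := by
    simp [hσ3, queryInit, Prog.eval, Store.setReg, Function.update]
  have h3_7 : σ3.reg 7 = σ3.mem (σ3.reg 6) := by
    simp [hσ3, queryInit, Prog.eval, Store.setReg, Function.update]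
  have h3_5 : σ3.reg 5 = σ3.reg 7 - 1 := by
    simp [hσ3, queryInit, Prog.eval, Store.setReg, Function.update, h2_1]
  obtain ⟨σ4, st4, h4_10, h4_p⟩ := query_steps h (σ := σ3) ((st3.frame 1 rfl).trans h2_1) h3_7 h3_5
    (by rw [st13.mem, h3_6]; exact hm.events)
  rw [h3_10, zero_add] at h4_10
  rw [← st4.mem] at h4_p
  have h4_1 : σ4.reg 1 = 1 := ((st3.seq st4).frame 1 rfl).trans h2_1
  have hs5 : queryEnd.Simple := by simp [queryEnd, Prog.Simple]
  have st5 := hs5.steps σ4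
  set σ5 := queryEnd.eval σ4 with hσ5
  have h5_5 : σ5.reg 5 = currentPrice h - queriesSinceSignal h := by
    by_cases h7 : σ4.reg 7 = 0 <;>
      simp [hσ5, queryEnd, Prog.eval, Store.setReg, Function.update, h7, h4_1, h4_10, h4_p]
  have st35 := st3.seq (st4.seq st5)
  have e1 : readInit.len = 5 := rfl
  have e3 : queryInit.len = 4 := rfl
  have e5 : queryEnd.len = 4 := rfl
  rw [e3] at st3
  rw [e1] at st1
  rw [e5] at st5
  have st15 := ((st1.seq st2).seq st35)
  by_cases hlt : queriesSinceSignal h < currentPrice h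
  · have hs6 : boxInit.Simple := by simp [boxInit, Prog.Simple]
    have st6 := hs6.steps σ5
    set σ6 := boxInit.eval σ5 with hσ6
    have e6 : boxInit.len = 3 := rfl
    rw [e6] at st6
    obtain ⟨σ7, st7, h7⟩ := box_steps (X := X) (W := W) (h := h) n (i := 0) (σ := σ6) (by omega)
      (((st35.seq st6).frame 1 rfl).trans h2_1)
      (((st2.seq (st35.seq st6)).frame 2 rfl).trans h1_2)
      (((st2.seq (st35.seq st6)).frame 3 rfl).trans h1_3)
      (((st35.seq st6).frame 4 rfl).trans h2_4)
      (((st35.seq st6).frame 17 rfl).trans h2_17)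
      (by simp [hσ6, boxInit, Prog.eval, Store.setReg, Function.update])
      (by
        have h5_2 : σ5.reg 2 = n := ((st2.seq st35).frame 2 rfl).trans h1_2
        have h5_17 : σ5.reg 17 = 0 := (st35.frame 17 rfl).trans h2_17
        simp [hσ6, boxInit, Prog.eval, Store.setReg, Function.update, h5_2, h5_17])
      (by simpa using ((st15.seq st6).frame 0 rfl).trans (h0 0))
      (by simp [hσ6, boxInit, Prog.eval, Store.setReg, Function.update])
      (by rw [(st15.seq st6).mem]; exact hm)
    refine ⟨σ7, (st1.seq <| st2.seq <| st3.seq <| st4.seq <| st5.seq <|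
      Steps.condTrue _ (by omega) (st6.seq st7)).mono (by omega), ?_⟩
    rw [if_pos hlt, h7]
  · refine ⟨_, (st1.seq <| st2.seq <| st3.seq <| st4.seq <| st5.seq <|
      Steps.condFalse _ (by omega) (Steps.const 5 (a := 0) (by omega) σ5)).mono (by omega), ?_⟩
    rw [if_neg hlt, Steps.setReg_frame (by rfl)]
    exact (st15.frame 0 rfl).trans (h0 0)

/-! ### From integer weights to probabilities, and the polynomial time bound. -/

theorem boxWeight_eq_sum (X : MSSC n m) (W : Fin m → ℕ) (h : List (Event n m)) (i : Fin n) :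
    boxWeight X W h i = ∑ s ∈ X.alive h with X.vec s i = true, W s := by
  rw [boxWeight, dif_pos i.2, Finset.sum_range]
  simp only [scenarioWeight, Fin.is_lt, dite_true, Fin.eta]
  rw [← Finset.sum_filter]
  exact Finset.sum_congr (by ext; simp) fun _ _ => rfl

theorem score_eq {X : MSSC n m} {W : Fin m → ℕ}
    (hW : ∀ s, X.D s = (W s : ℝ≥0∞) / ∑ r, (W r : ℝ≥0∞)) (h : List (Event n m)) (i : ℕ) :
    X.score (X.alive h) i = (boxWeight X W h i : ℝ≥0∞) / ∑ r, (W r : ℝ≥0∞) := by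
  by_cases hi : i < n
  · rw [MSSC.score, dif_pos hi, MSSC.mass, boxWeight_eq_sum X W h ⟨i, hi⟩]
    simp only [hW, ENNReal.div_eq_inv_mul, ← Finset.mul_sum, Nat.cast_sum]
  · simp [MSSC.score, boxWeight, hi]

theorem sum_weights_ne_zero {X : MSSC n m} {W : Fin m → ℕ}
    (hW : ∀ s, X.D s = (W s : ℝ≥0∞) / ∑ r, (W r : ℝ≥0∞)) : ∑ r, (W r : ℝ≥0∞) ≠ 0 := by
  intro h0
  obtain ⟨s, hs⟩ := X.D.support_nonempty
  rw [PMF.mem_support_iff, hW, Finset.sum_eq_zero_iff.mp h0 s (Finset.mem_univ s)] at hs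
  simp at hs

theorem code_greedyBuying {X : MSSC n m} {W : Fin m → ℕ}
    (hW : ∀ s, X.D s = (W s : ℝ≥0∞) / ∑ r, (W r : ℝ≥0∞)) (h : List (Event n m)) :
    (greedyBuying n m X h).code = if queriesSinceSignal h < currentPrice h then
        (if n = 0 then 0 else firstMax (boxWeight X W h) n + 1) else 0 := by
  have htop : ∑ r, (W r : ℝ≥0∞) ≠ ⊤ := by simp
  have hlt : ∀ i j, X.score (X.alive h) i < X.score (X.alive h) j ↔
      boxWeight X W h i < boxWeight X W h j := fun i j => by
    rw [score_eq hW, score_eq hW, ENNReal.div_eq_inv_mul, ENNReal.div_eq_inv_mul]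
    exact (ENNReal.mul_right_strictMono (ENNReal.inv_ne_zero.mpr htop)
      (ENNReal.inv_ne_top.mpr (sum_weights_ne_zero hW))).lt_iff_lt.trans Nat.cast_lt
  rw [greedyBuying]
  split_ifs with h1 h2 h3 h3
  · omega
  · simp [Action.code, MSSC.greedyBox, firstMax_congr hlt]
  · rfl
  · omega
  · rfl

theorem length_le_inputLength (l : List ℕ) : l.length ≤ inputLength l := by
  induction l with
  | nil => simp
  | cons a l ih => simp only [inputLength, List.map_cons, List.sum_cons, List.length_cons] at *; omega

theorem bounded_inputStore (l : List ℕ) : (inputStore l).Bounded (inputLength l) := by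
  refine ⟨fun x => by simp [inputStore], fun a => ?_⟩
  simp only [inputStore]
  by_cases ha : a < l.length
  · rw [List.getD_eq_getElem _ _ ha]
    have := List.single_le_sum (l := l.map fun a => a.size + 1) (fun _ _ => Nat.zero_le _)
      (l[a].size + 1) (List.mem_map_of_mem (f := fun a : ℕ => a.size + 1) (l.getElem_mem ha))
    rw [inputLength]
    omega
  · rw [List.getD_eq_default _ _ (by omega)]
    simp

theorem length_inputCode_ge (X : MSSC n m) (W : Fin m → ℕ) (h : List (Event n m)) :
    m * (n + 1) + h.length ≤ (inputCode X W h).length := by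
  have h1 : h.length ≤ (h.flatMap Event.code).length := by
    induction h with
    | nil => simp
    | cons e h ih =>
      rw [List.flatMap_cons, List.length_append, List.length_cons]
      have : 1 ≤ e.code.length := by cases e <;> simp [Event.code]
      omega
  have h2 : ((List.ofFn fun s => W s :: List.ofFn fun i => (X.vec s i).toNat).flatten).length =
      m * (n + 1) := by
    simp [List.length_flatten, List.map_ofFn, Function.comp_def]
  simp only [inputCode, List.length_cons, List.length_append, h2]
  omega

theorem greedyBuying_polyTime : greedyBuying.PolyTime := by
  -- The step count is at most `50 * (L + 1) ^ 3` for input length `L`, and the initial digit bound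
  -- is `B = L + 2`; the polynomial is the cost bound of `Steps.exec` for these values.
  refine ⟨greedyProg, 50 * (Polynomial.X + 1) ^ 3 *
    (1 + 2 * (Polynomial.X + 2 + 50 * (Polynomial.X + 1) ^ 3)), fun n m X W hW h => ?_⟩
  set L := inputLength (inputCode X W h) with hL
  obtain ⟨σ', st, h0⟩ := greedyProg_steps (holds_inputStore X W h) fun x => rfl
  have hlen := (length_inputCode_ge X W h).trans (length_le_inputLength _)
  rw [← hL] at hlen
  -- Without scenarios the input would hold only the binary digits of `n`, and `n` could not be
  -- bounded by its length.
  have hm : 1 ≤ m := by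
    obtain ⟨s, -⟩ := X.D.support_nonempty
    exact s.pos
  have hmL : m ≤ L := by nlinarith
  have hnL : n ≤ L := by nlinarith
  have hhL : h.length ≤ L := by omega
  have hN : n * (m * (20 * h.length + 30) + 20) + m * 4 + 10 * h.length + 50 ≤ 50 * (L + 1) ^ 3 :=
    calc n * (m * (20 * h.length + 30) + 20) + m * 4 + 10 * h.length + 50
        ≤ L * (L * (20 * L + 30) + 20) + L * 4 + 10 * L + 50 := by gcongr
      _ ≤ 50 * (L + 1) ^ 3 := by ring_nf; omega
  obtain ⟨-, k, hk, hex⟩ := (st.mono hN).exec (L + 2) (by omega)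
    ((bounded_inputStore _).mono (by omega))
  refine ⟨k, σ', hex, h0.trans (code_greedyBuying hW h).symm, hk.trans (le_of_eq ?_)⟩
  simp

end BuyingInfo

theorem mainTheorem3 :
    ∃ A : BuyingInfo.Learner,
      A.IsGreedyBuying ∧ A.PolyTime ∧ A.FewDecisions ∧ A.Competitive 8 :=
  ⟨BuyingInfo.greedyBuying, BuyingInfo.greedyBuying_isGreedyBuying,
    BuyingInfo.greedyBuying_polyTime, BuyingInfo.greedyBuying_fewDecisions,
    BuyingInfo.greedyBuying_competitive⟩
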